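/- **Proposition (Bethe vectors and factorial Grothendieck polynomials).** Let $n,k\ge 0$, $N=n+k$, let $K$ be a field (for instance the field of rational functions in indeterminates), and let $\beta$, $t=(t_1,\dots,t_N)$, $y=(y_1,\dots,y_n)$, $z=(z_1,\dots,z_k)$ be in $K$ with $1+\beta t_j\neq 0$ for all $j$. Put $$x\oplus y=x+y+\beta xy,\qquad x\ominus y=\frac{x-y}{1+\beta y},\qquad \ominus x=0\ominus x,\qquad \Pi(x)=\prod_i(1+\beta x_i),$$ $t'=(t_N,\dots,t_2,t_1)$, $\ominus t=(\ominus t_1,\dots,\ominus t_N)$, $\ominus t'=(\ominus t_N,\dots,\ominus t_1)$; these sequences are extended by $0$ to all indices in $\mathbb Z$. *Partitions.* A partition $\lambda\subset(k^n)$ (at most $n$ parts, $\lambda_1\le k$) corresponds to the binary string $b(\lambda)\in\{0,1\}^N$ with $1$-letters exactly at the positions $\lambda_{n+1-i}+i$, $1\le i\le n$. Write $\lambda'$ for the conjugate partition, $\lambda^\vee\subset(k^n)$ for the partition of the reversed string, $\lambda^*\subset(n^k)$ for the partition of the string with $0$ and $1$ exchanged, $t_\lambda=(t_{\lambda_n+1},\dots,t_{\lambda_1+n})$,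 and $t_{\lambda^*}$ for the tuple of the $t_j$ at the $0$-letters of $b(\lambda)$. For parameters $a=(a_j)_{j\in\mathbb Z}$ let $$G_\lambda(x_1,\dots,x_m|a)=\sum_T\beta^{|T|-|\lambda|}\prod_{(i,j)\in\lambda}\ \prod_{r\in T(i,j)}\bigl(x_r\oplus a_{r+j-i}\bigr),$$ the sum running over the set-valued tableaux $T$ of shape $\lambda$: each box $(i,j)$ carries a non-empty $T(i,j)\subset\{1,\dots,m\}$, with $\max T(i,j)\le\min T(i,j+1)$ and $\max T(i,j)<\min T(i+1,j)$, and $|T|=\sum_{(i,j)}|T(i,j)|$. *Operators.* Let $V=Kv_0\oplus Kv_1$, $\sigma^-v_1=v_0$, $\sigma^-v_0=0$, $\sigma^+v_0=v_1$, $\sigma^+v_1=0$. Let $v_\lambda=v_{b_1}\otimes\cdots\otimes v_{b_N}\in V^{\otimes N}$ for $b=b(\lambda)$, and let $\tilde v_\lambda$ be the dual basis vectors. Put $$L(x|t)=\begin{pmatrix}\sigma^+\sigma^-+(x\ominus t)\,\sigma^-\sigma^+&(1+\beta\,(x\ominus t))\,\sigma^+\\ \sigma^-&\sigma^-\sigma^+\end{pmatrix},\quad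 L'(x|t)=\begin{pmatrix}\sigma^-\sigma^++(x\oplus t)\,\sigma^+\sigma^-&\sigma^+\\ (1+\beta\,(x\oplus t))\,\sigma^-&\sigma^+\sigma^-\end{pmatrix},$$ and let $L^\vee$, $L^*$ be obtained from $L$, $L'$ respectively by moving the factor $1+\beta(\cdot)$ to the other off-diagonal entry, so that $L^\vee$ has off-diagonal entries $\sigma^+$, $(1+\beta(x\ominus t))\sigma^-$ and $L^*$ has $(1+\beta(x\oplus t))\sigma^+$, $\sigma^-$. With $L_j$ denoting $L(x|t_j)$ acting on the $j$-th factor of $V^{\otimes N}$, form the $2\times2$ block matrices $$M(x|t)=L_N\cdots L_1,\quad M'(x|t)=L'_N\cdots L'_1,\quad M^\vee(x|t)=L^\vee_1\cdots L^\vee_N,\quad M^*(x|t)=L^*_1\cdots L^*_N.$$ Denote the blocks of $M$ by $\begin{pmatrix}A&B\\C&D\end{pmatrix}$ and those of $M'$ by $\begin{pmatrix}A'&B'\\C'&D'\end{pmatrix}$. Let $C^\vee(x|t)$ be the lower left block of the transpose of $M^\vee$ in the auxiliary space (that is, its upper right block), and $B^*(x|t)$ the upper right block of the transpose of $M^*$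 in the auxiliary space (that is, its lower left block). They act on the dual space through the identification $\tilde v_\lambda\leftrightarrow v_\lambda$; as such they are the transposes of $C(x|t)$ and $B'(x|t)$. *Bethe vectors.* Let $|0\rangle=v_0^{\otimes N}$, $|N\rangle=v_1^{\otimes N}$, let $\langle 0|$, $\langle N|$ be the corresponding dual basis vectors, and put $$|y_1,\dots,y_n\rangle=B(y_n|t)\cdots B(y_1|t)|0\rangle,\qquad |z_1,\dots,z_k\rangle=C'(z_k|t)\cdots C'(z_1|t)|N\rangle,$$ $$\langle y_1,\dots,y_n|=\langle0|C^\vee(y_n|t)\cdots C^\vee(y_1|t),\qquad \langle z_1,\dots,z_k|=\langle N|B^*(z_k|t)\cdots B^*(z_1|t),$$ where in the second line the operators are applied to the dual vector successively from left to right. Then $$|y_1,\dots,y_n\rangle=\Pi(y)\sum_{\lambda\subset(k^n)}\frac{G_{\lambda^\vee}(y|\ominus t')}{\Pi(t_\lambda)}\,v_\lambda,\qquad |z_1,\dots,z_k\rangle=\Pi(z)\sum_{\lambda\subset(k^n)}G_{\lambda^*}(z|t)\,\Pi(t_{\lambda^*})\,v_\lambda,$$ $$\langle y_1,\dots,y_n|=\sum_{\lambda\subset(k^n)}G_\lambda(y|\ominus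 t)\,\tilde v_\lambda,\qquad \langle z_1,\dots,z_k|=\sum_{\lambda\subset(k^n)}G_{\lambda'}(z|t')\,\tilde v_\lambda .$$ -/

import Mathlib

open scoped TensorProduct

namespace BetheGrothendieck

noncomputable section

/-! ### The multiplicative formal group law -/

section GroupLaw

variable {K : Type*} [Field K]

/-- `x ⊕ y = x + y + β x y`. -/
def oplus (β x y : K) : K := x + y + β * x * y

/-- `x ⊖ y = (x - y) / (1 + β y)`. -/
def ominus (β x y : K) : K := (x - y) / (1 + β * y)

/-- `Π(x) = ∏ᵢ (1 + β xᵢ)` for a finite tuple `x`. -/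
def Pi1 (β : K) {m : ℕ} (x : Fin m → K) : K := ∏ i, (1 + β * x i)

/-- The sequence `(t_j)_{j ∈ ℤ}` obtained from `(t_1, …, t_N)` by putting `t_j = 0` unless
`1 ≤ j ≤ N`. The tuple is indexed from `0`, so `t_j` is the entry with index `j - 1`. -/
def extend {N : ℕ} (t : Fin N → K) (j : ℤ) : K :=
  if h : 1 ≤ j ∧ j ≤ N then t ⟨(j - 1).toNat, by omega⟩ else 0

/-- `⊖t = (⊖t_1, …, ⊖t_N)` with `⊖x = 0 ⊖ x`. -/
def neg (β : K) {N : ℕ} (t : Fin N → K) : Fin N → K := fun j => ominus β 0 (t j)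

/-- `t' = (t_N, …, t_2, t_1)`. -/
def reverse {N : ℕ} (t : Fin N → K) : Fin N → K := fun j => t j.rev

end GroupLaw

/-! ### Binary strings and boxed partitions -/

section Strings

variable {N : ℕ}

/-- The set `I_b` of positions of the `1`-letters of a binary string `b`. -/
def ones (b : Fin N → Fin 2) : Finset (Fin N) := Finset.univ.filter fun j => b j = 1

/-- `|b|`, the number of `1`-letters. -/
def weight (b : Fin N → Fin 2) : ℕ := (ones b).card

/-- The positions `w(1) < ⋯ < w(n)` of the `1`-letters (`i` and the value are counted from `0`). -/
def pos (b : Fin N → Fin 2) (i : Fin (weight b)) : Fin N := (ones b).orderEmbOfFin rfl i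

/-- The boxed partition `λ ⊂ (k^n)` of `b`, with `n = |b|` and `k = N - n`, determined by
`w(i) = λ_{n+1-i} + i`. Rows are counted from `0`. -/
def part (b : Fin N → Fin 2) (i : Fin (weight b)) : ℕ := (pos b i.rev : ℕ) - (i.rev : ℕ)

/-- The Young diagram of the partition of `b`; rows and columns are counted from `0`. -/
def diagram (b : Fin N → Fin 2) : Finset (ℕ × ℕ) :=
  Finset.univ.biUnion fun i : Fin (weight b) =>
    (Finset.range (part b i)).image fun j => ((i : ℕ), j)

/-- The diagram of the conjugate partition. -/
def conjugate (θ : Finset (ℕ × ℕ)) : Finset (ℕ × ℕ) := θ.image Prod.swap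

/-- `b^∨`, the reversed binary string; its partition is `λ^∨`. -/
def vee (b : Fin N → Fin 2) : Fin N → Fin 2 := fun j => b j.rev

/-- `b^*`, the binary string with `0`- and `1`-letters swapped; its partition is `λ^*`. -/
def star (b : Fin N → Fin 2) : Fin N → Fin 2 := fun j => 1 - b j

/-- `t_λ = (t_{λ_n + 1}, …, t_{λ_1 + n}) = (t_{w(1)}, …, t_{w(n)})`. -/
def sub {K : Type*} (t : Fin N → K) (b : Fin N → Fin 2) : Fin (weight b) → K := fun i => t (pos b i)

end Strings

/-! ### Set-valued tableaux and factorial Grothendieck polynomials -/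

section Grothendieck

/-- Set-valued tableaux of shape `θ` with entries in `[n]`: every box carries a non-empty set,
`max T(i,j) ≤ min T(i,j+1)` and `max T(i,j) < min T(i+1,j)`. -/
structure IsSetValuedTableau {n : ℕ} (θ : Finset (ℕ × ℕ)) (T : θ → Finset (Fin n)) : Prop where
  nonempty : ∀ c, (T c).Nonempty
  row : ∀ c d : θ, d.1 = (c.1.1, c.1.2 + 1) → ∀ r ∈ T c, ∀ s ∈ T d, r ≤ s
  col : ∀ c d : θ, d.1 = (c.1.1 + 1, c.1.2) → ∀ r ∈ T c, ∀ s ∈ T d, r < s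

open Classical in
/-- `SVT(θ)`, with entries in `[n]`. -/
def SVT (n : ℕ) (θ : Finset (ℕ × ℕ)) : Finset (θ → Finset (Fin n)) :=
  Finset.univ.filter (IsSetValuedTableau θ)

/-- The factorial Grothendieck polynomial
`G_θ(x|a) = ∑_T β^{|T| - |θ|} ∏_{(i,j) ∈ θ, r ∈ T(i,j)} x_r ⊕ a_{r+j-i}`.
The entry `r` is stored as `r - 1`; the content `j - i` does not depend on whether rows and
columns are counted from `0` or from `1`. -/
def G {K : Type*} [Field K] (β : K) {n : ℕ} (θ : Finset (ℕ × ℕ)) (x : Fin n → K) (a : ℤ → K) : K :=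
  ∑ T ∈ SVT n θ, β ^ ((∑ c, (T c).card) - θ.card) *
    ∏ c : θ, ∏ r ∈ T c, oplus β (x r) (a (((r : ℕ) : ℤ) + 1 + (c.1.2 : ℤ) - (c.1.1 : ℤ)))

end Grothendieck

/-! ### The quantum space, the `L`-operators and the monodromy matrices -/

section YangBaxter

variable (K : Type*) [Field K]

/-- `V = K v_0 ⊕ K v_1`. -/
abbrev V : Type _ := Fin 2 → K

/-- The quantum space `V^{⊗N}`. -/
abbrev QSpace (N : ℕ) : Type _ := ⨂[K] _ : Fin N, V K

/-- The spin basis `v_b = v_{b_1} ⊗ ⋯ ⊗ v_{b_N}`, indexed by binary strings. -/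
def spinBasis (N : ℕ) : Module.Basis (Fin N → Fin 2) K (QSpace K N) :=
  Basis.piTensorProduct fun _ => Pi.basisFun K (Fin 2)

/-- `σ⁻ v_1 = v_0`, `σ⁻ v_0 = 0`. -/
def sigmaMinus : Module.End K (V K) := Matrix.toLin' !![0, 1; 0, 0]

/-- `σ⁺ v_0 = v_1`, `σ⁺ v_1 = 0`. -/
def sigmaPlus : Module.End K (V K) := Matrix.toLin' !![0, 0; 1, 0]

/-- The vector `v_ε ⊗ ⋯ ⊗ v_ε`; `|0⟩` for `ε = 0` and `|N⟩` for `ε = 1`. -/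
def uniform (N : ℕ) (ε : Fin 2) : QSpace K N := spinBasis K N fun _ => ε

variable {K}

/-- The operator acting as `X` on the `j`-th tensor factor and as the identity on the others. -/
def site {N : ℕ} (j : Fin N) (X : Module.End K (V K)) : Module.End K (QSpace K N) :=
  PiTensorProduct.map (Function.update (fun _ => LinearMap.id) j X)

/-- `L(x|t)`, as a `2 × 2` block matrix over the auxiliary space. -/
def L (β x t : K) : Matrix (Fin 2) (Fin 2) (Module.End K (V K)) :=
  !![sigmaPlus K * sigmaMinus K + ominus β x t • (sigmaMinus K * sigmaPlus K),
      (1 + β * ominus β x t) • sigmaPlus K;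
    sigmaMinus K, sigmaMinus K * sigmaPlus K]

/-- `L'(x|t)`. -/
def L' (β x t : K) : Matrix (Fin 2) (Fin 2) (Module.End K (V K)) :=
  !![sigmaMinus K * sigmaPlus K + oplus β x t • (sigmaPlus K * sigmaMinus K), sigmaPlus K;
    (1 + β * oplus β x t) • sigmaMinus K, sigmaPlus K * sigmaMinus K]

/-- `L^∨(x|t)`. -/
def Lvee (β x t : K) : Matrix (Fin 2) (Fin 2) (Module.End K (V K)) :=
  !![sigmaPlus K * sigmaMinus K + ominus β x t • (sigmaMinus K * sigmaPlus K), sigmaPlus K;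
    (1 + β * ominus β x t) • sigmaMinus K, sigmaMinus K * sigmaPlus K]

/-- `L^*(x|t)`. -/
def Lstar (β x t : K) : Matrix (Fin 2) (Fin 2) (Module.End K (V K)) :=
  !![sigmaMinus K * sigmaPlus K + oplus β x t • (sigmaPlus K * sigmaMinus K),
      (1 + β * oplus β x t) • sigmaPlus K;
    sigmaMinus K, sigmaPlus K * sigmaMinus K]

variable {N : ℕ}

/-- `M(x|t) = L_N ⋯ L_2 L_1`, where `L_j = L(x|t_j)` acts on the auxiliary space and the `j`-th
factor of the quantum space. -/
def M (β x : K) (t : Fin N → K) : Matrix (Fin 2) (Fin 2) (Module.End K (QSpace K N)) :=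
  (List.ofFn fun j => (L β x (t j)).map (site j)).reverse.prod

/-- `M'(x|t) = L'_N ⋯ L'_2 L'_1`. -/
def M' (β x : K) (t : Fin N → K) : Matrix (Fin 2) (Fin 2) (Module.End K (QSpace K N)) :=
  (List.ofFn fun j => (L' β x (t j)).map (site j)).reverse.prod

/-- `M^∨(x|t) = L^∨_1 L^∨_2 ⋯ L^∨_N`. -/
def Mvee (β x : K) (t : Fin N → K) : Matrix (Fin 2) (Fin 2) (Module.End K (QSpace K N)) :=
  (List.ofFn fun j => (Lvee β x (t j)).map (site j)).prod

/-- `M^*(x|t) = L^*_1 L^*_2 ⋯ L^*_N`. -/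
def Mstar (β x : K) (t : Fin N → K) : Matrix (Fin 2) (Fin 2) (Module.End K (QSpace K N)) :=
  (List.ofFn fun j => (Lstar β x (t j)).map (site j)).prod

/-- `B(x|t)`, the upper right block of `M(x|t)`. -/
def B (β x : K) (t : Fin N → K) : Module.End K (QSpace K N) := M β x t 0 1

/-- `C'(x|t)`, the lower left block of `M'(x|t)`. -/
def C' (β x : K) (t : Fin N → K) : Module.End K (QSpace K N) := M' β x t 1 0

/-- `C^∨(x|t)`, the lower left block of the transpose of `M^∨(x|t)` in the auxiliary space. In the
spin basis this is the transpose of `C(x|t)`, the lower left block of `M(x|t)`, because the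
transpose of `M` in the quantum space is the transpose of `M^∨` in the auxiliary space.
(`Matrix.transpose` exchanges the blocks without changing them.) -/
def Cvee (β x : K) (t : Fin N → K) : Module.End K (QSpace K N) := (Mvee β x t).transpose 1 0

/-- `B^*(x|t)`, the upper right block of the transpose of `M^*(x|t)` in the auxiliary space. In the
spin basis this is the transpose of `B'(x|t)`, the upper right block of `M'(x|t)`. -/
def Bstar (β x : K) (t : Fin N → K) : Module.End K (QSpace K N) := (Mstar β x t).transpose 0 1

/-- The dual spin basis vector `ṽ_b` in the dual of the quantum space. -/
def dualSpin (b : Fin N → Fin 2) : Module.Dual K (QSpace K N) := (spinBasis K N).coord b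

/-! ### Bethe vectors -/

/-- `|y_1, …, y_n⟩ = B(y_n|t) ⋯ B(y_1|t) |0⟩`. -/
def bethe (β : K) (t : Fin N → K) {n : ℕ} (y : Fin n → K) : QSpace K N :=
  (List.ofFn fun i => B β (y i) t).reverse.prod (uniform K N 0)

/-- `|z_1, …, z_k⟩ = C'(z_k|t) ⋯ C'(z_1|t) |N⟩`. -/
def bethe' (β : K) (t : Fin N → K) {k : ℕ} (z : Fin k → K) : QSpace K N :=
  (List.ofFn fun i => C' β (z i) t).reverse.prod (uniform K N 1)

/-- `⟨y_1, …, y_n| = ⟨0| C^∨(y_n|t) ⋯ C^∨(y_1|t)`: the operators `C^∨(y_n|t), …, C^∨(y_1|t)` are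
applied in this order to `⟨0|`, in the dual quantum space, which is identified with the quantum
space through `ṽ_b ↔ v_b`. -/
def dualBethe (β : K) (t : Fin N → K) {n : ℕ} (y : Fin n → K) : Module.Dual K (QSpace K N) :=
  (spinBasis K N).toDual ((List.ofFn fun i => Cvee β (y i) t).prod (uniform K N 0))

/-- `⟨z_1, …, z_k| = ⟨N| B^*(z_k|t) ⋯ B^*(z_1|t)`, in the dual quantum space. -/
def dualBethe' (β : K) (t : Fin N → K) {k : ℕ} (z : Fin k → K) : Module.Dual K (QSpace K N) :=
  (spinBasis K N).toDual ((List.ofFn fun i => Bstar β (z i) t).prod (uniform K N 1))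

end YangBaxter

end

end BetheGrothendieck

/-! Both sides obey the same recursion in the number of variables. A set-valued tableau in `n + 1`
letters is a tableau in `n` letters on the boxes that still hold a smaller letter, together with the
set of boxes holding the largest letter. Once the smaller letters are fixed, the boxes choose
independently, so `G_succ` writes `G` for `θ` as a sum over `μ ⊆ θ` of a product of local weights
times `G` for `μ` in one variable fewer.

The matrix elements of a Bethe operator between spin basis vectors are entries of a product of `N`
scalar 2×2 matrices, normalised here as `transfer`. The core is `transfer_branch`: the entry `0 1`
realises the branching of the diagram of `b`, and the entry `0 0` that of the diagram with one more
full row on top, as if `b` were followed by a `1`. The two statements close under appending a letter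
and are proved together by induction on `N`. This gives `sum_transfer_mul_G`: one more operator adds
one more variable.

The four families reduce to `transfer` after relabelling strings by the identity, reversal, exchange
of letters, or both. For `B` and `C'` a diagonal gauge transformation (`prod_apply_mul_prod_eq`) is
also needed; it produces the prefactors `Π`. The dual vectors apply their operators in the opposite
order, which is harmless because these commute, by the exchange relations
`sum_transfer_mul_transfer`. -/

namespace BetheGrothendieck

noncomputable section

/-! ### Diagrams of binary strings as sets of inversions. -/

section Diagrams

lemma card_filter_lt_orderEmbOfFin {α : Type*} [LinearOrder α] (s : Finset α) {m : ℕ}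
    (h : s.card = m) (i : Fin m) :
    (s.filter fun r => r < s.orderEmbOfFin h i).card = i := by
  have : (s.filter fun r => r < s.orderEmbOfFin h i) =
      (Finset.Iio i).map (s.orderEmbOfFin h).toEmbedding := by
    ext r
    simp only [Finset.mem_filter, Finset.mem_map, Finset.mem_Iio, RelEmbedding.coe_toEmbedding]
    constructor
    · rintro ⟨hr, hlt⟩
      have : r ∈ Set.range (s.orderEmbOfFin h) := by simpa using hr
      obtain ⟨j, rfl⟩ := this
      exact ⟨j, by simpa using hlt, rfl⟩
    · rintro ⟨j, hj, rfl⟩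
      exact ⟨s.orderEmbOfFin_mem h j, by simpa using hj⟩
  rw [this, Finset.card_map, Fin.card_Iio]

lemma card_filter_gt_orderEmbOfFin {α : Type*} [LinearOrder α] (s : Finset α) {m : ℕ}
    (h : s.card = m) (i : Fin m) :
    (s.filter fun r => s.orderEmbOfFin h i < r).card = i.rev := by
  have : (s.filter fun r => s.orderEmbOfFin h i < r) =
      (Finset.Ioi i).map (s.orderEmbOfFin h).toEmbedding := by
    ext r
    simp only [Finset.mem_filter, Finset.mem_map, Finset.mem_Ioi, RelEmbedding.coe_toEmbedding]
    constructor
    · rintro ⟨hr, hlt⟩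
      have : r ∈ Set.range (s.orderEmbOfFin h) := by simpa using hr
      obtain ⟨j, rfl⟩ := this
      exact ⟨j, by simpa using hlt, rfl⟩
    · rintro ⟨j, hj, rfl⟩
      exact ⟨s.orderEmbOfFin_mem h j, by simpa using hj⟩
  rw [this, Finset.card_map, Fin.card_Ioi, Fin.val_rev]
  omega

lemma lt_card_iff_exists_card_filter_lt {α : Type*} [LinearOrder α] (s : Finset α) (j : ℕ) :
    j < s.card ↔ ∃ q ∈ s, (s.filter fun r => r < q).card = j := by
  constructor
  · intro hj
    exact ⟨_, s.orderEmbOfFin_mem rfl ⟨j, hj⟩, card_filter_lt_orderEmbOfFin s rfl ⟨j, hj⟩⟩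
  · rintro ⟨q, hq, rfl⟩
    exact Finset.card_lt_card (Finset.filter_ssubset.2 ⟨q, hq, lt_irrefl q⟩)

variable {N : ℕ}

/-- Exactly `i` ones precede the `i`-th one, so subtracting `i` from its position leaves the zeros
before it; in particular the natural subtraction in `part` does not truncate. -/
lemma part_rev (b : Fin N → Fin 2) (i : Fin (weight b)) :
    part b i.rev = (Finset.univ.filter fun r => b r = 0 ∧ r < pos b i).card := by
  have h1 := card_filter_lt_orderEmbOfFin (ones b) rfl i
  have h2 : (Finset.univ.filter fun r => r < pos b i).card =
      ((ones b).filter fun r => r < pos b i).card +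
        (Finset.univ.filter fun r => b r = 0 ∧ r < pos b i).card := by
    rw [← Finset.card_union_of_disjoint]
    · congr 1
      ext r
      simp only [ones, Finset.mem_filter, Finset.mem_union, Finset.mem_univ, true_and]
      have : b r = 0 ∨ b r = 1 := by omega
      tauto
    · rw [Finset.disjoint_left]
      intro r
      simp only [ones, Finset.mem_filter, Finset.mem_univ, true_and]
      intro h h'
      simp [h.1] at h'
  have h3 : (Finset.univ.filter fun r => r < pos b i).card = (pos b i : ℕ) := by
    have : (Finset.univ.filter fun r => r < pos b i) = Finset.Iio (pos b i) := by
      ext; simp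
    rw [this, Fin.card_Iio]
  change ((ones b).filter fun r => r < pos b i).card = i at h1
  simp only [part, Fin.rev_rev]
  omega

/-- A box of the diagram of `b` is an inversion: a `0`-letter to the left of a `1`-letter. -/
lemma mem_diagram (b : Fin N → Fin 2) (c : ℕ × ℕ) :
    c ∈ diagram b ↔ ∃ p q, q < p ∧ b p = 1 ∧ b q = 0 ∧
      (Finset.univ.filter fun r => b r = 1 ∧ p < r).card = c.1 ∧
      (Finset.univ.filter fun r => b r = 0 ∧ r < q).card = c.2 := by
  obtain ⟨i, j⟩ := c
  have key : ∀ p j, (j < (Finset.univ.filter fun r => b r = 0 ∧ r < p).card ↔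
      ∃ q, q < p ∧ b q = 0 ∧ (Finset.univ.filter fun r => b r = 0 ∧ r < q).card = j) := by
    intro p j
    rw [lt_card_iff_exists_card_filter_lt]
    refine exists_congr fun q => ?_
    simp only [Finset.mem_filter, Finset.mem_univ, true_and, Finset.filter_filter]
    constructor
    · rintro ⟨⟨h1, h2⟩, h3⟩
      refine ⟨h2, h1, ?_⟩
      rw [← h3]
      congr 1
      ext r
      simp only [Finset.mem_filter, Finset.mem_univ, true_and]
      exact ⟨fun h => ⟨⟨h.1, h.2.trans h2⟩, h.2⟩, fun h => ⟨h.1.1, h.2⟩⟩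
    · rintro ⟨h2, h1, h3⟩
      refine ⟨⟨h1, h2⟩, ?_⟩
      rw [← h3]
      congr 1
      ext r
      simp only [Finset.mem_filter, Finset.mem_univ, true_and]
      exact ⟨fun h => ⟨h.1.1, h.2⟩, fun h => ⟨⟨h.1, h.2.trans h2⟩, h.2⟩⟩
  have gt : ∀ i : Fin (weight b),
      (Finset.univ.filter fun r => b r = 1 ∧ pos b i < r).card = i.rev := by
    intro i
    refine Eq.trans ?_ (card_filter_gt_orderEmbOfFin (ones b) rfl i)
    congr 1
    ext r
    have hr : r ∈ ones b ↔ b r = 1 := by simp [ones]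
    simp only [Finset.mem_filter, Finset.mem_univ, true_and, hr]
    rfl
  have hpos : ∀ i : Fin (weight b), b (pos b i) = 1 := fun i =>
    (Finset.mem_filter.1 ((ones b).orderEmbOfFin_mem rfl i)).2
  simp only [diagram, Finset.mem_biUnion, Finset.mem_univ, true_and, Finset.mem_image,
    Finset.mem_range, Prod.mk.injEq]
  constructor
  · rintro ⟨i, j, hj, rfl, rfl⟩
    rw [← Fin.rev_rev i, part_rev, key] at hj
    obtain ⟨q, h1, h2, h3⟩ := hj
    exact ⟨pos b i.rev, q, h1, hpos _, h2, by rw [gt, Fin.rev_rev], h3⟩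
  · rintro ⟨p, q, h1, h2, h3, rfl, rfl⟩
    have : p ∈ Set.range ((ones b).orderEmbOfFin rfl) := by
      rw [Finset.range_orderEmbOfFin]
      simpa [ones] using h2
    obtain ⟨i', rfl⟩ : ∃ i' : Fin (weight b), pos b i' = p := this
    refine ⟨i'.rev, _, ?_, (gt i').symm, rfl⟩
    rw [part_rev]
    exact (key _ _).2 ⟨q, h1, h3, rfl⟩

/-- Reversing the string and exchanging its letters sends inversions to inversions and interchanges
the two counts that serve as row and column. -/
lemma conjugate_diagram (b : Fin N → Fin 2) :
    conjugate (diagram b) = diagram (vee (star b)) := by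
  have card_rev : ∀ P : Fin N → Prop, ∀ [DecidablePred P],
      (Finset.univ.filter fun r : Fin N => P r.rev).card = (Finset.univ.filter P).card := by
    intro P _
    refine Finset.card_bij (fun r _ => r.rev) (by simp) (by simp) fun r hr => ⟨r.rev, ?_⟩
    simpa using hr
  have e1 : ∀ c : Fin 2, 1 - c = 1 ↔ c = 0 := by decide
  have e0 : ∀ c : Fin 2, 1 - c = 0 ↔ c = 1 := by decide
  ext ⟨i, j⟩
  simp only [conjugate, Finset.mem_image, Prod.exists, Prod.swap_prod_mk, Prod.mk.injEq,
    mem_diagram, vee, star, e1, e0]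
  constructor
  · rintro ⟨_, _, ⟨p, q, h1, h2, h3, h4, h5⟩, rfl, rfl⟩
    refine ⟨q.rev, p.rev, by simpa using h1, by simpa, by simpa, ?_, ?_⟩
    · rw [← h5, ← card_rev]
      congr! 3
      · rw [Fin.rev_rev]
      · exact Fin.rev_lt_rev
    · rw [← h4, ← card_rev]
      congr! 3
      · rw [Fin.rev_rev]
      · exact Fin.rev_lt_rev
  · rintro ⟨p, q, h1, h2, h3, h4, h5⟩
    refine ⟨_, _, ⟨q.rev, p.rev, by simpa using h1, by simpa, by simpa, ?_, ?_⟩, rfl, rfl⟩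
    · rw [← h5, ← card_rev]
      congr! 3
      simp
    · rw [← h4, ← card_rev]
      congr! 3
      simp

lemma weight_snoc (b : Fin N → Fin 2) (c : Fin 2) :
    weight (Fin.snoc b c : Fin (N + 1) → Fin 2) = weight b + if c = 1 then 1 else 0 := by
  simp only [weight, ones, Finset.card_filter, Fin.sum_univ_castSucc, Fin.snoc_castSucc,
    Fin.snoc_last]

lemma weight_le (b : Fin N → Fin 2) : weight b ≤ N := by
  exact (Finset.card_le_univ (ones b)).trans_eq (Fintype.card_fin N)

lemma card_zeros (b : Fin N → Fin 2) :
    (Finset.univ.filter fun r => b r = 0).card = N - weight b := by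
  have h : ∀ r, b r = 0 ↔ ¬ b r = 1 := fun r => by omega
  have := Finset.card_filter_add_card_filter_not (s := Finset.univ) fun r : Fin N => b r = 1
  simp only [Finset.card_univ, Fintype.card_fin] at this
  simp only [h, weight, ones]
  omega

/-- Add a row of `k` boxes on top of a diagram. -/
def addRow (k : ℕ) (θ : Finset (ℕ × ℕ)) : Finset (ℕ × ℕ) :=
  (Finset.range k).image (Prod.mk 0) ∪ θ.image fun c => (c.1 + 1, c.2)

@[simp] lemma zero_mem_addRow {k : ℕ} {θ : Finset (ℕ × ℕ)} {j : ℕ} :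
    (0, j) ∈ addRow k θ ↔ j < k := by simp [addRow]

@[simp] lemma succ_mem_addRow {k : ℕ} {θ : Finset (ℕ × ℕ)} {i j : ℕ} :
    (i + 1, j) ∈ addRow k θ ↔ (i, j) ∈ θ := by simp [addRow]

lemma card_filter_snoc_lt_castSucc (b : Fin N → Fin 2) (c d : Fin 2) (q : Fin N) :
    (Finset.univ.filter fun r => (Fin.snoc b c : Fin (N + 1) → Fin 2) r = d ∧
      r < q.castSucc).card = (Finset.univ.filter fun r => b r = d ∧ r < q).card := by
  simp only [Finset.card_filter, Fin.sum_univ_castSucc, Fin.snoc_castSucc, Fin.snoc_last,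
    Fin.castSucc_lt_castSucc_iff, (Fin.castSucc_lt_last q).not_gt, and_false, if_false, add_zero]

lemma card_filter_castSucc_lt_snoc (b : Fin N → Fin 2) (c d : Fin 2) (q : Fin N) :
    (Finset.univ.filter fun r => (Fin.snoc b c : Fin (N + 1) → Fin 2) r = d ∧
      q.castSucc < r).card =
      (Finset.univ.filter fun r => b r = d ∧ q < r).card + if c = d then 1 else 0 := by
  simp only [Finset.card_filter, Fin.sum_univ_castSucc, Fin.snoc_castSucc, Fin.snoc_last,
    Fin.castSucc_lt_castSucc_iff, Fin.castSucc_lt_last q, and_true]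

/-- A final zero has no one to its right, so it creates no inversion. -/
lemma diagram_snoc_zero (b : Fin N → Fin 2) :
    diagram (Fin.snoc b 0 : Fin (N + 1) → Fin 2) = diagram b := by
  ext c
  simp only [mem_diagram, Fin.exists_iff_castSucc, Fin.snoc_castSucc, Fin.snoc_last,
    (Fin.castSucc_lt_last _).not_gt, card_filter_snoc_lt_castSucc, card_filter_castSucc_lt_snoc,
    Fin.castSucc_lt_castSucc_iff]
  simp

/-- A final one is inverted with every zero. Since rows are numbered by the ones to the right, these
inversions form row zero and the old rows move down. -/
lemma diagram_snoc_one (b : Fin N → Fin 2) :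
    diagram (Fin.snoc b 1 : Fin (N + 1) → Fin 2) = addRow (N - weight b) (diagram b) := by
  ext ⟨i, j⟩
  have hlast : (Finset.univ.filter fun r => (Fin.snoc b 1 : Fin (N + 1) → Fin 2) r = 1 ∧
      Fin.last N < r).card = 0 := by
    simp [(Fin.le_last _).not_gt]
  simp only [← card_zeros, mem_diagram, Fin.exists_iff_castSucc, Fin.snoc_castSucc,
    Fin.snoc_last, (Fin.castSucc_lt_last _).not_gt, card_filter_snoc_lt_castSucc,
    card_filter_castSucc_lt_snoc, Fin.castSucc_lt_castSucc_iff, hlast]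
  rcases i with _ | i
  · rw [zero_mem_addRow, lt_card_iff_exists_card_filter_lt]
    simp [Finset.filter_filter]
  · rw [succ_mem_addRow, mem_diagram]
    simp

lemma lt_of_mem_diagram {b : Fin N → Fin 2} {c : ℕ × ℕ} (h : c ∈ diagram b) :
    c.2 < N - weight b := by
  rw [mem_diagram] at h
  obtain ⟨p, q, -, -, h, -, h'⟩ := h
  rw [← card_zeros, lt_card_iff_exists_card_filter_lt]
  exact ⟨q, by simpa using h, by rw [Finset.filter_filter]; exact h'⟩

lemma mem_diagram_of_succ_mem {N : ℕ} {b : Fin N → Fin 2} {i j : ℕ} (h : (i + 1, j) ∈ diagram b) :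
    (i, j) ∈ diagram b := by
  induction N generalizing i with
  | zero => simp [mem_diagram] at h
  | succ N ih =>
    rw [← Fin.snoc_init_self b] at h ⊢
    have : b (Fin.last N) = 0 ∨ b (Fin.last N) = 1 := by omega
    rcases this with hb | hb
    · rw [hb, diagram_snoc_zero] at h ⊢
      exact ih h
    · rw [hb, diagram_snoc_one] at h ⊢
      rw [succ_mem_addRow] at h
      rcases i with _ | i
      · simpa using lt_of_mem_diagram h
      · simpa using ih h

lemma diagram_eq_empty_of_weight_eq_zero {b : Fin N → Fin 2} (h : weight b = 0) :
    diagram b = ∅ := by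
  refine Finset.eq_empty_of_forall_notMem fun c hc => ?_
  obtain ⟨p, -, -, hp, -⟩ := (mem_diagram b c).1 hc
  rw [weight, Finset.card_eq_zero] at h
  have : p ∈ ones b := by simpa [ones] using hp
  simp [h] at this

end Diagrams

/-! ### Branching of set-valued tableaux: removing the largest letter. -/

section Branching

variable {K : Type*} [Field K]

/-- The contribution of a box `c` filled with the set `S` to the weight of a set-valued tableau. -/
def boxWeight (β : K) {n : ℕ} (x : Fin n → K) (a : ℤ → K) (c : ℕ × ℕ) (S : Finset (Fin n)) : K :=
  β ^ (S.card - 1) * ∏ r ∈ S, oplus β (x r) (a (((r : ℕ) : ℤ) + 1 + (c.2 : ℤ) - (c.1 : ℤ)))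

-- The truncated exponent `S.card - 1` is what makes this true; empty boxes then drop out of
-- products over a larger shape.
@[simp] lemma boxWeight_empty (β : K) {n : ℕ} (x : Fin n → K) (a : ℤ → K) (c : ℕ × ℕ) :
    boxWeight β x a c ∅ = 1 := by simp [boxWeight]

/-- The row and column conditions of a set-valued tableau, where boxes may be empty. -/
def IsWeaklyFilled {n : ℕ} (θ : Finset (ℕ × ℕ)) (T : θ → Finset (Fin n)) : Prop :=
  (∀ c d : θ, d.1 = (c.1.1, c.1.2 + 1) → ∀ r ∈ T c, ∀ s ∈ T d, r ≤ s) ∧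
    ∀ c d : θ, d.1 = (c.1.1 + 1, c.1.2) → ∀ r ∈ T c, ∀ s ∈ T d, r < s

/-- The boxes with a non-empty entry. -/
def filledBoxes {n : ℕ} {θ : Finset (ℕ × ℕ)} (T : θ → Finset (Fin n)) : Finset (ℕ × ℕ) :=
  (Finset.univ.filter fun c => (T c).Nonempty).map (Function.Embedding.subtype _)

lemma filledBoxes_subset {n : ℕ} {θ : Finset (ℕ × ℕ)} (T : θ → Finset (Fin n)) :
    filledBoxes T ⊆ θ := by
  intro c
  simp only [filledBoxes, Finset.mem_map]
  rintro ⟨d, -, rfl⟩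
  exact d.2

lemma mem_filledBoxes {n : ℕ} {θ : Finset (ℕ × ℕ)} (T : θ → Finset (Fin n)) (c : θ) :
    c.1 ∈ filledBoxes T ↔ (T c).Nonempty := by
  simp [filledBoxes]

lemma filledBoxes_eq_iff {n : ℕ} {θ μ : Finset (ℕ × ℕ)} (h : μ ⊆ θ) (T : θ → Finset (Fin n)) :
    filledBoxes T = μ ↔ ∀ c : θ, (T c).Nonempty ↔ c.1 ∈ μ := by
  constructor
  · rintro rfl c
    exact (mem_filledBoxes T c).symm
  · intro hT
    ext c
    constructor
    · intro hc
      have := filledBoxes_subset T hc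
      exact (hT ⟨c, this⟩).1 ((mem_filledBoxes T ⟨c, this⟩).1 hc)
    · intro hc
      exact (mem_filledBoxes T ⟨c, h hc⟩).2 ((hT ⟨c, h hc⟩).2 hc)

open Classical in
lemma G_eq_sum_SVT (β : K) {n : ℕ} (θ : Finset (ℕ × ℕ)) (x : Fin n → K) (a : ℤ → K) :
    G β θ x a = ∑ T ∈ SVT n θ, ∏ c : θ, boxWeight β x a c (T c) := by
  refine Finset.sum_congr rfl fun T hT => ?_
  have hT' : IsSetValuedTableau θ T := by simpa [SVT] using hT
  simp only [boxWeight]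
  rw [Finset.prod_mul_distrib, Finset.prod_pow_eq_pow_sum]
  congr 2
  have : ∑ c, (T c).card = ∑ c, ((T c).card - 1) + θ.card := by
    rw [← Fintype.card_coe θ, ← Finset.card_univ, Finset.card_eq_sum_ones,
      ← Finset.sum_add_distrib]
    refine Finset.sum_congr rfl fun c _ => ?_
    have := (hT'.nonempty c).card_pos
    omega
  omega

open Classical in
-- Tableaux of all subshapes `μ` are placed in the single type of fillings of `θ` with empty boxes
-- allowed, so that sums over different `μ` can later be merged by support.
lemma G_eq_sum_of_subset (β : K) {n : ℕ} {θ μ : Finset (ℕ × ℕ)} (h : μ ⊆ θ) (x : Fin n → K)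
    (a : ℤ → K) :
    G β μ x a = ∑ T : θ → Finset (Fin n),
      if filledBoxes T = μ ∧ IsWeaklyFilled θ T then ∏ c : θ, boxWeight β x a c (T c) else 0 := by
  rw [G_eq_sum_SVT, ← Finset.sum_filter]
  refine Finset.sum_bij' (fun T _ c => if hc : c.1 ∈ μ then T ⟨c.1, hc⟩ else ∅)
    (fun T _ c => T ⟨c.1, h c.2⟩) ?_ ?_ ?_ ?_ ?_
  · intro T hT
    have hT' : IsSetValuedTableau μ T := by simpa [SVT] using hT
    rw [Finset.mem_filter, filledBoxes_eq_iff h]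
    refine ⟨Finset.mem_univ _, fun c => ?_, fun c d hcd r hr s hs => ?_,
      fun c d hcd r hr s hs => ?_⟩
    · by_cases hc : c.1 ∈ μ
      · simp [hc, hT'.nonempty]
      · simp [hc]
    · by_cases hc : c.1 ∈ μ
      · by_cases hd : d.1 ∈ μ
        · simp only [hc, hd, dite_true] at hr hs
          exact hT'.row ⟨c.1, hc⟩ ⟨d.1, hd⟩ hcd r hr s hs
        · simp [hd] at hs
      · simp [hc] at hr
    · by_cases hc : c.1 ∈ μ
      · by_cases hd : d.1 ∈ μ
        · simp only [hc, hd, dite_true] at hr hs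
          exact hT'.col ⟨c.1, hc⟩ ⟨d.1, hd⟩ hcd r hr s hs
        · simp [hd] at hs
      · simp [hc] at hr
  · intro T hT
    rw [Finset.mem_filter, filledBoxes_eq_iff h] at hT
    obtain ⟨-, h1, h2, h3⟩ := hT
    simp only [SVT, Finset.mem_filter, Finset.mem_univ, true_and]
    exact ⟨fun c => (h1 ⟨c.1, h c.2⟩).2 c.2, fun c d hcd => h2 _ _ hcd, fun c d hcd => h3 _ _ hcd⟩
  · intro T hT
    ext c
    simp
  · intro T hT
    rw [Finset.mem_filter, filledBoxes_eq_iff h] at hT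
    funext c
    by_cases hc : c.1 ∈ μ
    · simp [hc]
    · have := (not_congr (hT.2.1 c)).2 hc
      rw [Finset.not_nonempty_iff_eq_empty] at this
      simp [hc, this]
  · intro T hT
    -- Equal to `1` off `μ`, so its products over `μ` and over `θ` coincide.
    let F : ℕ × ℕ → K := fun c => boxWeight β x a c (if hc : c ∈ μ then T ⟨c, hc⟩ else ∅)
    have e1 : ∏ c : θ, F c = ∏ c ∈ θ, F c := Finset.prod_coe_sort θ F
    have e2 : ∏ c : μ, F c = ∏ c ∈ μ, F c := Finset.prod_coe_sort μ F
    have e3 : ∏ c ∈ μ, F c = ∏ c ∈ θ, F c :=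
      Finset.prod_subset h fun c _ hc => by simp [F, hc]
    change _ = ∏ c : θ, F c
    rw [e1, ← e3, ← e2]
    exact Finset.prod_congr rfl fun c _ => by simp [F]

/-- A subset of `[n + 1]` is a subset of `[n]` together with the information whether it contains
the largest element. -/
def finsetSuccEquiv (n : ℕ) : Finset (Fin n) × Bool ≃ Finset (Fin (n + 1)) where
  toFun p := p.1.map Fin.castSuccEmb ∪ if p.2 then {Fin.last n} else ∅
  invFun S := (Finset.univ.filter fun r => r.castSucc ∈ S, decide (Fin.last n ∈ S))
  left_inv p := by
    obtain ⟨S, s⟩ := p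
    ext r
    · cases s <;> simp [Fin.castSucc_ne_last]
    · cases s <;> simp [Fin.castSucc_ne_last]
  right_inv S := by
    ext r
    cases r using Fin.lastCases with
    | last => by_cases h : Fin.last n ∈ S <;> simp [h, Fin.castSucc_ne_last]
    | cast r => by_cases h : Fin.last n ∈ S <;> simp [h, Fin.castSucc_ne_last]

lemma castSucc_mem_finsetSuccEquiv {n : ℕ} (S : Finset (Fin n)) (s : Bool) (r : Fin n) :
    r.castSucc ∈ finsetSuccEquiv n (S, s) ↔ r ∈ S := by
  cases s <;> simp [finsetSuccEquiv, Fin.castSucc_ne_last]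

lemma last_mem_finsetSuccEquiv {n : ℕ} (S : Finset (Fin n)) (s : Bool) :
    Fin.last n ∈ finsetSuccEquiv n (S, s) ↔ s = true := by
  cases s <;> simp [finsetSuccEquiv, Fin.castSucc_ne_last]

/-- The new letter costs an extra `β` only in a box that is already occupied, because the first
letter of a box is free. -/
lemma boxWeight_finsetSuccEquiv (β : K) {n : ℕ} (x : Fin (n + 1) → K) (a : ℤ → K) (c : ℕ × ℕ)
    (S : Finset (Fin n)) (s : Bool) :
    boxWeight β x a c (finsetSuccEquiv n (S, s)) =
      (if s then (if S.Nonempty then β else 1) *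
        oplus β (x (Fin.last n)) (a ((n : ℤ) + 1 + c.2 - c.1)) else 1) *
        boxWeight β (fun r => x r.castSucc) a c S := by
  have hd : Disjoint (S.map Fin.castSuccEmb) {Fin.last n} := by
    simp [Fin.castSucc_ne_last]
  cases s
  · simp [finsetSuccEquiv, boxWeight]
  · simp only [finsetSuccEquiv, boxWeight, Equiv.coe_fn_mk, if_true, Finset.card_union_of_disjoint hd,
      Finset.prod_union hd, Finset.card_map, Finset.prod_map, Finset.card_singleton,
      Finset.prod_singleton, Fin.coe_castSuccEmb, Fin.val_castSucc, Fin.val_last]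
    rcases S.eq_empty_or_nonempty with rfl | hS
    · simp
    · obtain ⟨m, hm⟩ : ∃ m, S.card = m + 1 := ⟨S.card - 1, by have := hS.card_pos; omega⟩
      simp only [hm, hS, if_true, Nat.add_sub_cancel]
      ring

open Classical in
/-- The weight of the skew shape `θ / μ`, filled with a single letter which may also be added to
boxes of `μ`; it is `0` unless such a filling exists. -/
def branchWeight (β : K) (w : ℕ × ℕ → K) (θ μ : Finset (ℕ × ℕ)) : K :=
  ∏ c ∈ θ, if (c.1, c.2 + 1) ∈ μ ∨ (c.1 + 1, c.2) ∈ θ then (if c ∈ μ then 1 else 0)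
    else (if c ∈ μ then 1 + β * w c else w c)

/-- The largest letter must fill every box without smaller letters. It is excluded when the right
neighbour holds a smaller letter, and also whenever a box lies below at all, since that box would
need a strictly larger entry. Each condition involves a single value of `s`. -/
lemma isSetValuedTableau_finsetSuccEquiv_iff {n : ℕ} {θ : Finset (ℕ × ℕ)}
    (T : θ → Finset (Fin n)) (s : θ → Bool) :
    IsSetValuedTableau θ (fun c => finsetSuccEquiv n (T c, s c)) ↔ IsWeaklyFilled θ T ∧
      ∀ c : θ, (s c = false → c.1 ∈ filledBoxes T) ∧
        (s c = true → ¬ ((c.1.1, c.1.2 + 1) ∈ filledBoxes T ∨ (c.1.1 + 1, c.1.2) ∈ θ)) := by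
  constructor
  · intro h
    refine ⟨⟨fun c d hcd r hr q hq => ?_, fun c d hcd r hr q hq => ?_⟩,
      fun c => ⟨fun hs => ?_, ?_⟩⟩
    · simpa using h.row c d hcd r.castSucc (by rwa [castSucc_mem_finsetSuccEquiv]) q.castSucc
        (by rwa [castSucc_mem_finsetSuccEquiv])
    · simpa using h.col c d hcd r.castSucc (by rwa [castSucc_mem_finsetSuccEquiv]) q.castSucc
        (by rwa [castSucc_mem_finsetSuccEquiv])
    · obtain ⟨r, hr⟩ := h.nonempty c
      rw [mem_filledBoxes]
      cases r using Fin.lastCases with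
      | last => simp [last_mem_finsetSuccEquiv, hs] at hr
      | cast r => exact ⟨r, by rwa [castSucc_mem_finsetSuccEquiv] at hr⟩
    · rintro hs (hc | hc)
      · have hd := filledBoxes_subset T hc
        obtain ⟨r, hr⟩ := (mem_filledBoxes T ⟨_, hd⟩).1 hc
        have := h.row c ⟨_, hd⟩ rfl (Fin.last n) (by rwa [last_mem_finsetSuccEquiv]) r.castSucc
          (by rwa [castSucc_mem_finsetSuccEquiv])
        exact absurd this (Fin.castSucc_lt_last r).not_ge
      · obtain ⟨r, hr⟩ := h.nonempty ⟨_, hc⟩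
        have := h.col c ⟨_, hc⟩ rfl (Fin.last n) (by rwa [last_mem_finsetSuccEquiv]) r hr
        exact absurd this (Fin.le_last r).not_gt
  · rintro ⟨⟨h1, h2⟩, h3⟩
    refine ⟨fun c => ?_, fun c d hcd r hr q hq => ?_, fun c d hcd r hr q hq => ?_⟩
    · cases hs : s c
      · obtain ⟨r, hr⟩ := (mem_filledBoxes T c).1 ((h3 c).1 hs)
        exact ⟨r.castSucc, by rwa [castSucc_mem_finsetSuccEquiv]⟩
      · exact ⟨Fin.last n, by rw [last_mem_finsetSuccEquiv]⟩
    · cases q using Fin.lastCases with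
      | last => exact Fin.le_last r
      | cast q =>
        rw [castSucc_mem_finsetSuccEquiv] at hq
        cases r using Fin.lastCases with
        | last =>
          rw [last_mem_finsetSuccEquiv] at hr
          exact absurd (Or.inl (hcd ▸ (mem_filledBoxes T d).2 ⟨q, hq⟩)) ((h3 c).2 hr)
        | cast r =>
          rw [castSucc_mem_finsetSuccEquiv] at hr
          simpa using h1 c d hcd r hr q hq
    · cases r using Fin.lastCases with
      | last =>
        rw [last_mem_finsetSuccEquiv] at hr
        exact absurd (Or.inr (hcd ▸ d.2)) ((h3 c).2 hr)
      | cast r =>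
        rw [castSucc_mem_finsetSuccEquiv] at hr
        cases q using Fin.lastCases with
        | last => exact Fin.castSucc_lt_last r
        | cast q =>
          rw [castSucc_mem_finsetSuccEquiv] at hq
          simpa using h2 c d hcd r hr q hq

open Classical in
lemma sum_isSetValuedTableau_finsetSuccEquiv (β : K) {n : ℕ} {θ : Finset (ℕ × ℕ)}
    (x : Fin (n + 1) → K) (a : ℤ → K) (T : θ → Finset (Fin n)) :
    (∑ s : θ → Bool, if IsSetValuedTableau θ (fun c => finsetSuccEquiv n (T c, s c)) then
      ∏ c : θ, boxWeight β x a c (finsetSuccEquiv n (T c, s c)) else 0) =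
    if IsWeaklyFilled θ T then
      branchWeight β (fun c => oplus β (x (Fin.last n)) (a ((n : ℤ) + 1 + c.2 - c.1))) θ
        (filledBoxes T) * ∏ c : θ, boxWeight β (fun r => x r.castSucc) a c (T c)
    else 0 := by
  by_cases hT : IsWeaklyFilled θ T
  swap
  · simp [isSetValuedTableau_finsetSuccEquiv_iff, hT]
  set μ := filledBoxes T with hμ
  simp only [isSetValuedTableau_finsetSuccEquiv_iff, hT, true_and, if_true]
  let g : θ → Bool → K := fun c s =>
    if (s = false → c.1 ∈ μ) ∧ (s = true → ¬ ((c.1.1, c.1.2 + 1) ∈ μ ∨ (c.1.1 + 1, c.1.2) ∈ θ))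
    then boxWeight β x a c (finsetSuccEquiv n (T c, s)) else 0
  have h1 : ∀ s : θ → Bool, (if ∀ c : θ, (s c = false → c.1 ∈ μ) ∧
      (s c = true → ¬ ((c.1.1, c.1.2 + 1) ∈ μ ∨ (c.1.1 + 1, c.1.2) ∈ θ)) then
      ∏ c : θ, boxWeight β x a c (finsetSuccEquiv n (T c, s c)) else 0) = ∏ c, g c (s c) := by
    intro s
    split_ifs with h
    · exact Finset.prod_congr rfl fun c _ => by simp only [g]; rw [if_pos (h c)]
    · push Not at h
      obtain ⟨c, hc⟩ := h
      refine (Finset.prod_eq_zero (Finset.mem_univ c) ?_).symm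
      simp only [g]
      rw [if_neg]
      intro h'
      obtain ⟨h2, h3⟩ := hc h'.1
      exact h'.2 h2 h3
  -- Distributivity: the sum over all placements of the largest letter is the product over boxes of
  -- the two-term sums of `g c`.
  rw [Finset.sum_congr rfl fun s _ => h1 s, ← Fintype.piFinset_univ, ← Finset.prod_univ_sum,
    branchWeight, ← Finset.prod_coe_sort θ, ← Finset.prod_mul_distrib]
  refine Finset.prod_congr rfl fun c _ => ?_
  have hc : (T c).Nonempty ↔ c.1 ∈ μ := (mem_filledBoxes T c).symm
  simp only [g, Fintype.sum_bool, boxWeight_finsetSuccEquiv, hc]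
  by_cases h2 : (c.1.1, c.1.2 + 1) ∈ μ ∨ (c.1.1 + 1, c.1.2) ∈ θ <;>
    by_cases h3 : c.1 ∈ μ <;> simp [h2, h3]
  ring

/-- Removing the largest letter from all set-valued tableaux of shape `θ`. -/
lemma G_succ (β : K) {n : ℕ} (θ : Finset (ℕ × ℕ)) (x : Fin (n + 1) → K) (a : ℤ → K) :
    G β θ x a = ∑ μ ∈ θ.powerset,
      branchWeight β (fun c => oplus β (x (Fin.last n)) (a ((n : ℤ) + 1 + c.2 - c.1))) θ μ *
        G β μ (fun r => x r.castSucc) a := by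
  classical
  have hl : G β θ x a = ∑ T : θ → Finset (Fin n),
      ∑ s : θ → Bool, if IsSetValuedTableau θ (fun c => finsetSuccEquiv n (T c, s c)) then
      ∏ c : θ, boxWeight β x a c (finsetSuccEquiv n (T c, s c)) else 0 := by
    rw [G_eq_sum_SVT, SVT, Finset.sum_filter, ← Fintype.sum_prod_type',
      ← Equiv.sum_comp ((Equiv.arrowProdEquivProdArrow θ (fun _ => Finset (Fin n))
        (fun _ => Bool)).symm.trans (Equiv.piCongrRight fun _ => finsetSuccEquiv n))]
    rfl
  have hr : ∀ μ ∈ θ.powerset,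
      branchWeight β (fun c => oplus β (x (Fin.last n)) (a ((n : ℤ) + 1 + c.2 - c.1))) θ μ *
        G β μ (fun r => x r.castSucc) a = ∑ T : θ → Finset (Fin n), if filledBoxes T = μ then
      (if IsWeaklyFilled θ T then
      branchWeight β (fun c => oplus β (x (Fin.last n)) (a ((n : ℤ) + 1 + c.2 - c.1))) θ
        (filledBoxes T) * ∏ c : θ, boxWeight β (fun r => x r.castSucc) a c (T c)
      else 0) else 0 := by
    intro μ hμ
    rw [G_eq_sum_of_subset β (Finset.mem_powerset.1 hμ), Finset.mul_sum]
    refine Finset.sum_congr rfl fun T _ => ?_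
    by_cases h1 : filledBoxes T = μ
    · by_cases h2 : IsWeaklyFilled θ T <;> simp [h1, h2]
    · simp [h1]
  rw [hl, Finset.sum_congr rfl hr]
  refine Eq.trans (Finset.sum_congr rfl fun T _ => ?_) Finset.sum_comm
  rw [sum_isSetValuedTableau_finsetSuccEquiv, Finset.sum_ite_eq,
    if_pos (Finset.mem_powerset.2 (filledBoxes_subset T))]

lemma G_empty (β : K) {n : ℕ} (x : Fin n → K) (a : ℤ → K) : G β ∅ x a = 1 := by
  classical
  rw [G_eq_sum_SVT]
  have : SVT n ∅ = Finset.univ := by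
    ext T
    simp only [SVT, Finset.mem_filter, Finset.mem_univ, true_and, iff_true]
    exact ⟨fun c => absurd c.2 (Finset.notMem_empty _), fun c => absurd c.2 (Finset.notMem_empty _),
      fun c => absurd c.2 (Finset.notMem_empty _)⟩
  rw [this]
  simp

/-- `G_θ` vanishes if a column of `θ` is longer than the number of letters. -/
lemma G_eq_zero (β : K) {n : ℕ} {θ : Finset (ℕ × ℕ)} (h : ∀ i ≤ n, (i, 0) ∈ θ) (x : Fin n → K)
    (a : ℤ → K) : G β θ x a = 0 := by
  classical
  rw [G_eq_sum_SVT]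
  refine Finset.sum_eq_zero fun T hT => ?_
  have hT' : IsSetValuedTableau θ T := by simpa [SVT] using hT
  exfalso
  -- Strict growth down the first column forces an entry at least `n` in row `n`, whereas letters
  -- are below `n`.
  have : ∀ i (hi : i ≤ n), ∀ r ∈ T ⟨(i, 0), h i hi⟩, i ≤ r := by
    intro i
    induction i with
    | zero => intros; omega
    | succ i ih =>
      intro hi r hr
      obtain ⟨s, hs⟩ := hT'.nonempty ⟨(i, 0), h i (by omega)⟩
      have h1 := ih (by omega) s hs
      have h2 := hT'.col ⟨(i, 0), h i (by omega)⟩ ⟨(i + 1, 0), h _ hi⟩ rfl s hs r hr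
      rw [Fin.lt_def] at h2
      omega
  obtain ⟨r, hr⟩ := hT'.nonempty ⟨(n, 0), h n le_rfl⟩
  have := this n le_rfl r hr
  omega

end Branching

/-! ### Row operators, and how branching sums change with the top row. -/

section Transfer

variable {K : Type*} [Field K]

/-- The matrix elements, in the quantum space, of the `L`-operator with weight `u`. -/
def vertex (β u : K) (c c' : Fin 2) : Matrix (Fin 2) (Fin 2) K :=
  if c = 0 then (if c' = 0 then !![u, 0; 0, 1] else !![0, 0; 1 + β * u, 0])
  else (if c' = 0 then !![0, 1; 0, 0] else !![1, 0; 0, 0])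

/-- The matrix elements, in the quantum space, of the monodromy matrix with weights
`x ⊕ a_1, …, x ⊕ a_N`. -/
def transfer (β x : K) (a : ℤ → K) {N : ℕ} (b b' : Fin N → Fin 2) : Matrix (Fin 2) (Fin 2) K :=
  (List.ofFn fun j : Fin N =>
    vertex β (oplus β x (a (((j : ℕ) : ℤ) + 1))) (b j) (b' j)).prod

variable {N : ℕ}

lemma transfer_snoc (β x : K) (a : ℤ → K) (b b' : Fin N → Fin 2) (c c' : Fin 2) :
    transfer β x a (Fin.snoc b c : Fin (N + 1) → Fin 2) (Fin.snoc b' c') =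
      transfer β x a b b' * vertex β (oplus β x (a ((N : ℤ) + 1))) c c' := by
  simp only [transfer]
  rw [List.ofFn_succ', List.concat_eq_append, List.prod_append]
  simp

lemma sum_snoc {M : Type*} [AddCommMonoid M] (f : (Fin (N + 1) → Fin 2) → M) :
    ∑ b, f b = ∑ b : Fin N → Fin 2, f (Fin.snoc b 0) + ∑ b : Fin N → Fin 2, f (Fin.snoc b 1) := by
  rw [← Equiv.sum_comp (Fin.snocEquiv fun _ => Fin 2), Fintype.sum_prod_type, Fin.sum_univ_two]
  rfl

/-- Each vertex conserves the number of ones, counting the auxiliary line. The entries `0 0` and `0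
1` feed each other when a letter is appended, hence the joint statement. -/
lemma transfer_eq_zero (β x : K) (a : ℤ → K) (b b' : Fin N → Fin 2) :
    (weight b ≠ weight b' → transfer β x a b b' 0 0 = 0) ∧
      (weight b ≠ weight b' + 1 → transfer β x a b b' 0 1 = 0) := by
  induction N with
  | zero =>
    have : b = b' := Subsingleton.elim _ _
    subst this
    simp [transfer]
  | succ N ih =>
    rw [← Fin.snoc_init_self b, ← Fin.snoc_init_self b']
    obtain ⟨h1, h2⟩ := ih (Fin.init b) (Fin.init b')
    generalize Fin.init b = d at *
    generalize Fin.init b' = d' at *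
    generalize b (Fin.last N) = c
    generalize b' (Fin.last N) = c'
    simp only [weight_snoc, transfer_snoc, Matrix.mul_apply, Fin.sum_univ_two]
    fin_cases c <;> fin_cases c' <;> simp [vertex] <;> grind

/-- The sum over the ways to remove the largest letter from tableaux of shape `θ`. -/
def branchSum (β : K) (w : ℕ × ℕ → K) (θ : Finset (ℕ × ℕ)) (f : Finset (ℕ × ℕ) → K) : K :=
  ∑ μ ∈ θ.powerset, branchWeight β w θ μ * f μ

lemma branchSum_eq_zero {β : K} {w : ℕ × ℕ → K} {θ : Finset (ℕ × ℕ)} {f : Finset (ℕ × ℕ) → K}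
    (h : ∀ μ, f μ = 0) : branchSum β w θ f = 0 := by
  simp [branchSum, h]

lemma addRow_eq_addRow_iff {k k' : ℕ} {θ θ' : Finset (ℕ × ℕ)} :
    addRow k θ = addRow k' θ' ↔ k = k' ∧ θ = θ' := by
  constructor
  · intro h
    refine ⟨?_, ?_⟩
    · have h1 : ∀ j, j < k ↔ j < k' := fun j => by
        rw [← zero_mem_addRow (θ := θ), h, zero_mem_addRow]
      have := h1 k
      have := h1 k'
      omega
    · ext ⟨i, j⟩
      rw [← succ_mem_addRow (k := k), h, succ_mem_addRow]
  · rintro ⟨rfl, rfl⟩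
    rfl

lemma prod_addRow {M : Type*} [CommMonoid M] (k : ℕ) (θ : Finset (ℕ × ℕ)) (F : ℕ × ℕ → M) :
    ∏ c ∈ addRow k θ, F c = (∏ j ∈ Finset.range k, F (0, j)) * ∏ c ∈ θ, F (c.1 + 1, c.2) := by
  rw [addRow, Finset.prod_union, Finset.prod_image, Finset.prod_image]
  · rintro ⟨_, _⟩ _ ⟨_, _⟩ _ h
    simpa using h
  · rintro _ _ _ _ h
    simpa using h
  · rw [Finset.disjoint_left]
    simp

/-- A sum over the subsets of `addRow k θ` whose terms vanish unless the subset contains the whole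
first row. -/
lemma sum_powerset_addRow {M : Type*} [AddCommMonoid M] (k : ℕ) (θ : Finset (ℕ × ℕ))
    (g : Finset (ℕ × ℕ) → M)
    (hg : ∀ μ ⊆ addRow k θ, ∀ j < k, (0, j) ∉ μ → g μ = 0) :
    ∑ μ ∈ (addRow k θ).powerset, g μ = ∑ μ ∈ θ.powerset, g (addRow k μ) := by
  symm
  rw [← Finset.sum_image (f := g) (g := addRow k) fun μ _ ν _ h => (addRow_eq_addRow_iff.1 h).2]
  refine Finset.sum_subset ?_ ?_
  · intro ν hν
    obtain ⟨μ, hμ, rfl⟩ := Finset.mem_image.1 hν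
    rw [Finset.mem_powerset] at hμ ⊢
    rintro ⟨_ | i, j⟩
    · simp
    · simpa using @hμ (i, j)
  · intro ν hν hν'
    by_contra hne
    apply hν'
    have h1 : ∀ j < k, (0, j) ∈ ν := fun j hj => by
      by_contra h
      exact hne (hg ν (Finset.mem_powerset.1 hν) j hj h)
    rw [Finset.mem_powerset] at hν
    have hs : ∀ i j, (i + 1, j) ∈ ν → (i, j) ∈ θ := fun i j h => by simpa using hν h
    refine Finset.mem_image.2 ⟨θ.filter fun c => (c.1 + 1, c.2) ∈ ν, by simp, ?_⟩
    ext ⟨_ | i, j⟩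
    · simpa using ⟨h1 j, fun h => by simpa using hν h⟩
    · simpa using hs i j

open Classical in
lemma branchWeight_addRow (β : K) (w : ℕ × ℕ → K) (k l : ℕ) (θ μ : Finset (ℕ × ℕ)) :
    branchWeight β w (addRow k θ) (addRow l μ) =
      (∏ j ∈ Finset.range k, if j + 1 < l ∨ (0, j) ∈ θ then (if j < l then 1 else 0)
        else (if j < l then 1 + β * w (0, j) else w (0, j))) *
        branchWeight β (fun c => w (c.1 + 1, c.2)) θ μ := by
  rw [branchWeight, prod_addRow]
  simp only [branchWeight, zero_mem_addRow, succ_mem_addRow, zero_add]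

/-- Two rows of equal length at the top. -/
lemma branchSum_addRow_addRow (β : K) (w : ℕ × ℕ → K) (k : ℕ) (θ : Finset (ℕ × ℕ))
    (f : Finset (ℕ × ℕ) → K) :
    branchSum β w (addRow k (addRow k θ)) f =
      branchSum β (fun c => w (c.1 + 1, c.2)) (addRow k θ) fun μ => f (addRow k μ) := by
  classical
  -- Every box of the top row has a box below it, so it cannot hold the largest letter: its factor
  -- is `1` if it lies in `μ` and `0` otherwise.
  rw [branchSum, sum_powerset_addRow]
  · refine Finset.sum_congr rfl fun μ _ => ?_
    rw [branchWeight_addRow, Finset.prod_eq_one, one_mul]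
    intro j hj
    simp [Finset.mem_range.1 hj]
  · intro μ _ j hj hμ
    rw [branchWeight, Finset.prod_eq_zero (i := (0, j)) (by simpa using hj), zero_mul]
    rw [if_pos (Or.inr _), if_neg hμ]
    rw [succ_mem_addRow]
    simpa using hj

/-- Going right from the gap at `j` to the box `k` in `μ`, some missing box has its right neighbour
in `μ`; its factor is zero. -/
lemma branchWeight_eq_zero_of_row (β : K) (w : ℕ × ℕ → K) {k : ℕ} {θ μ : Finset (ℕ × ℕ)}
    (hk : (0, k) ∈ μ) {j : ℕ} (hj : j < k + 1) (hμ : (0, j) ∉ μ) :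
    branchWeight β w (addRow (k + 1) θ) μ = 0 := by
  classical
  obtain ⟨d, rfl⟩ : ∃ d, k = j + d := ⟨k - j, by omega⟩
  induction d generalizing j with
  | zero => exact absurd hk hμ
  | succ d ih =>
    by_cases h : (0, j + 1) ∈ μ
    · rw [branchWeight, Finset.prod_eq_zero (i := (0, j)) (by simp)]
      rw [if_pos (Or.inl h), if_neg hμ]
    · have e : j + (d + 1) = (j + 1) + d := by omega
      rw [e] at hk ⊢
      exact ih h hk (by omega)

/-- Enlarging the first row by one box. -/
lemma branchSum_addRow_succ (β : K) (w : ℕ × ℕ → K) (k : ℕ) (θ : Finset (ℕ × ℕ))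
    (hθ : ∀ c ∈ θ, c.2 < k) (f : Finset (ℕ × ℕ) → K) :
    branchSum β w (addRow (k + 1) θ) f = w (0, k) * branchSum β w (addRow k θ) f +
      (1 + β * w (0, k)) *
        branchSum β (fun c => w (c.1 + 1, c.2)) θ fun μ => f (addRow (k + 1) μ) := by
  classical
  have hk : (0, k) ∉ addRow k θ := by simp
  have hk' : (0, k) ∉ θ := fun h => lt_irrefl _ (hθ _ h)
  have e : addRow (k + 1) θ = insert (0, k) (addRow k θ) := by
    ext ⟨_ | i, j⟩
    · simp; omega
    · simp
  -- Split by whether the new box `(0, k)` lies in `μ`. By `hθ` nothing is below it, so it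
  -- contributes `w` or `1 + β w`; in the second case the whole top row must lie in `μ`.
  have h1 : ∀ μ ∈ (addRow (k + 1) θ).powerset, branchWeight β w (addRow (k + 1) θ) μ * f μ =
      (if (0, k) ∈ μ then 0 else branchWeight β w (addRow (k + 1) θ) μ * f μ) +
      (if (0, k) ∈ μ then branchWeight β w (addRow (k + 1) θ) μ * f μ else 0) := by
    intro μ _
    split_ifs <;> simp
  rw [branchSum, Finset.sum_congr rfl h1, Finset.sum_add_distrib]
  congr 1
  · rw [e, Finset.sum_powerset_insert hk]
    rw [Finset.sum_eq_zero (s := (addRow k θ).powerset) (f := fun μ => if (0, k) ∈ insert (0, k) μ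
      then (0 : K) else _) fun μ _ => if_pos (Finset.mem_insert_self _ _), add_zero, branchSum,
      Finset.mul_sum]
    refine Finset.sum_congr rfl fun μ hμ => ?_
    rw [Finset.mem_powerset] at hμ
    have hkμ : (0, k) ∉ μ := fun h => hk (hμ h)
    have hkμ' : (0, k + 1) ∉ μ := fun h => by simpa using hμ h
    rw [if_neg hkμ, ← mul_assoc, branchWeight, Finset.prod_insert hk, branchWeight]
    congr 2
    · rw [if_neg, if_neg hkμ]
      rintro (h | h)
      · exact hkμ' h
      · rw [Finset.mem_insert, succ_mem_addRow] at h
        simp [hk'] at h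
    · refine Finset.prod_congr rfl fun c _ => ?_
      have : (c.1 + 1, c.2) ∈ insert (0, k) (addRow k θ) ↔ (c.1 + 1, c.2) ∈ addRow k θ := by
        simp
      simp only [this]
  · rw [sum_powerset_addRow]
    · rw [branchSum, Finset.mul_sum]
      refine Finset.sum_congr rfl fun μ hμ => ?_
      rw [if_pos (by simp), branchWeight_addRow, Finset.prod_range_succ, Finset.prod_eq_one,
        one_mul, mul_assoc]
      · simp [hk']
      · intro j hj
        rw [Finset.mem_range] at hj
        rw [if_pos (Or.inl (by omega)), if_pos (by omega)]
    · intro μ _ j hj hμ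
      split_ifs with h
      · rw [branchWeight_eq_zero_of_row β w h hj hμ, zero_mul]
      · rfl

end Transfer

/-! ### Row operators realise the branching rule and satisfy exchange relations. -/

section Transfer

variable {K : Type*} [Field K] {N : ℕ}

lemma transfer_snoc_zero_zero (β x : K) (a : ℤ → K) (b b' : Fin N → Fin 2) (α : Fin 2) :
    transfer β x a (Fin.snoc b 0 : Fin (N + 1) → Fin 2) (Fin.snoc b' 0) α 0 =
        oplus β x (a ((N : ℤ) + 1)) * transfer β x a b b' α 0 ∧
    transfer β x a (Fin.snoc b 0 : Fin (N + 1) → Fin 2) (Fin.snoc b' 0) α 1 =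
        transfer β x a b b' α 1 := by
  simp [transfer_snoc, vertex, Matrix.mul_apply, mul_comm]

lemma transfer_snoc_zero_one (β x : K) (a : ℤ → K) (b b' : Fin N → Fin 2) (α : Fin 2) :
    transfer β x a (Fin.snoc b 0 : Fin (N + 1) → Fin 2) (Fin.snoc b' 1) α 0 =
        (1 + β * oplus β x (a ((N : ℤ) + 1))) * transfer β x a b b' α 1 ∧
    transfer β x a (Fin.snoc b 0 : Fin (N + 1) → Fin 2) (Fin.snoc b' 1) α 1 = 0 := by
  simp [transfer_snoc, vertex, Matrix.mul_apply, mul_comm]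

lemma transfer_snoc_one_zero (β x : K) (a : ℤ → K) (b b' : Fin N → Fin 2) (α : Fin 2) :
    transfer β x a (Fin.snoc b 1 : Fin (N + 1) → Fin 2) (Fin.snoc b' 0) α 0 = 0 ∧
    transfer β x a (Fin.snoc b 1 : Fin (N + 1) → Fin 2) (Fin.snoc b' 0) α 1 =
        transfer β x a b b' α 0 := by
  simp [transfer_snoc, vertex, Matrix.mul_apply]

lemma transfer_snoc_one_one (β x : K) (a : ℤ → K) (b b' : Fin N → Fin 2) (α : Fin 2) :
    transfer β x a (Fin.snoc b 1 : Fin (N + 1) → Fin 2) (Fin.snoc b' 1) α 0 =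
        transfer β x a b b' α 0 ∧
    transfer β x a (Fin.snoc b 1 : Fin (N + 1) → Fin 2) (Fin.snoc b' 1) α 1 = 0 := by
  simp [transfer_snoc, vertex, Matrix.mul_apply]

/-- The action of the row operators on functions of diagrams, as sums over the ways to remove the
largest letter from a tableau. -/
lemma transfer_branch (β x : K) (a : ℤ → K) (b : Fin N → Fin 2) :
    (∀ f : Finset (ℕ × ℕ) → K, (∀ μ, (∀ n, weight b = n + 1 → (n, 0) ∈ μ) → f μ = 0) →
      ∑ b', transfer β x a b b' 0 1 * f (diagram b') =
        branchSum β (fun c => oplus β x (a ((weight b : ℤ) + c.2 - c.1))) (diagram b) f) ∧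
    ∀ f : Finset (ℕ × ℕ) → K, (∀ μ, (weight b, 0) ∈ μ → f μ = 0) →
      ∑ b', transfer β x a b b' 0 0 * f (diagram b') =
        branchSum β (fun c => oplus β x (a ((weight b : ℤ) + 1 + c.2 - c.1)))
          (addRow (N - weight b) (diagram b)) f := by
  induction N with
  | zero =>
    have hw : weight b = 0 := by have := weight_le b; omega
    have hd : ∀ b' : Fin 0 → Fin 2, diagram b' = ∅ := fun b' =>
      diagram_eq_empty_of_weight_eq_zero (by have := weight_le b'; omega)
    have ha : addRow 0 ∅ = ∅ := by simp [addRow]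
    -- At weight zero the condition in the first hypothesis is vacuous, so it says `f = 0`. This is
    -- needed: the operator side vanishes, while the branching sum of the empty diagram is `f ∅`.
    refine ⟨fun f hf => ?_, fun f hf => ?_⟩
    · have hf' : ∀ μ, f μ = 0 := fun μ => hf μ (by omega)
      rw [branchSum_eq_zero hf']
      simp [hf']
    · simp [hd, hw, ha, branchSum, branchWeight, transfer]
  | succ N ih =>
    rw [← Fin.snoc_init_self b]
    generalize b (Fin.last N) = c
    obtain ⟨ihA, ihB⟩ := ih (Fin.init b)
    have hN := weight_le (Fin.init b)
    generalize Fin.init b = d at *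
    have hc : c = 0 ∨ c = 1 := by omega
    rcases hc with rfl | rfl
    · refine ⟨fun f hf => ?_, fun f hf => ?_⟩
      · simp only [weight_snoc, diagram_snoc_zero, Fin.isValue, zero_ne_one, if_false,
          add_zero] at hf ⊢
        rw [sum_snoc]
        simp only [transfer_snoc_zero_zero, transfer_snoc_zero_one, diagram_snoc_zero, zero_mul,
          Finset.sum_const_zero, add_zero]
        exact ihA f hf
      · simp only [weight_snoc, diagram_snoc_zero, Fin.isValue, zero_ne_one, if_false,
          add_zero] at hf ⊢
        -- The box added at the end of the top row carries exactly the parameter of the new site, so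
        -- the two terms of `branchSum_addRow_succ` match the two vertices with letter `0`.
        have hu : (weight d : ℤ) + 1 + ((N - weight d : ℕ) : ℤ) - ((0 : ℕ) : ℤ) = (N : ℤ) + 1 := by
          omega
        rw [show N + 1 - weight d = (N - weight d) + 1 by omega,
          branchSum_addRow_succ _ _ _ _ fun c hc => lt_of_mem_diagram hc, sum_snoc]
        simp only [transfer_snoc_zero_zero, transfer_snoc_zero_one, diagram_snoc_zero,
          diagram_snoc_one, mul_assoc, ← Finset.mul_sum, hu]
        congr 2
        · exact ihB f hf
        · have h1 : ∀ b', transfer β x a d b' 0 1 * f (addRow (N - weight b') (diagram b')) =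
              transfer β x a d b' 0 1 * f (addRow (N - weight d + 1) (diagram b')) := by
            intro b'
            by_cases h : weight d = weight b' + 1
            · rw [show N - weight b' = N - weight d + 1 by omega]
            · rw [(transfer_eq_zero β x a d b').2 h, zero_mul, zero_mul]
          rw [Finset.sum_congr rfl fun b' _ => h1 b']
          refine (ihA (fun μ => f (addRow (N - weight d + 1) μ)) ?_).trans ?_
          · intro μ hμ
            apply hf
            -- Adding a row shifts the forbidden box down by one; at weight zero the new non-empty
            -- row itself contains `(0, 0)`.
            rcases hn : weight d with _ | n
            · simp
            · simpa using hμ n hn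
          · congr! 4
            push_cast
            ring
    · refine ⟨fun f hf => ?_, fun f hf => ?_⟩
      · simp only [weight_snoc, diagram_snoc_one, if_true] at hf ⊢
        rw [sum_snoc]
        simp only [transfer_snoc_one_zero, transfer_snoc_one_one, diagram_snoc_zero, zero_mul,
          Finset.sum_const_zero, add_zero]
        rw [ihB f fun μ hμ => hf μ fun n hn => by rwa [← Nat.succ_injective hn]]
        simp
      · simp only [weight_snoc, diagram_snoc_one, if_true] at hf ⊢
        rw [Nat.add_sub_add_right, branchSum_addRow_addRow, sum_snoc]
        simp only [transfer_snoc_one_zero, transfer_snoc_one_one, diagram_snoc_one, zero_mul,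
          Finset.sum_const_zero, zero_add]
        have h1 : ∀ b', transfer β x a d b' 0 0 * f (addRow (N - weight b') (diagram b')) =
            transfer β x a d b' 0 0 * f (addRow (N - weight d) (diagram b')) := by
          intro b'
          by_cases h : weight d = weight b'
          · rw [h]
          · rw [(transfer_eq_zero β x a d b').1 h, zero_mul, zero_mul]
        rw [Finset.sum_congr rfl fun b' _ => h1 b']
        refine (ihB (fun μ => f (addRow (N - weight d) μ)) ?_).trans ?_
        · intro μ hμ
          apply hf
          simpa using hμ
        · congr! 4
          push_cast
          ring

/-- The branching rule for the Grothendieck polynomials of boxed partitions, in terms of the row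
operators. -/
lemma sum_transfer_mul_G (β : K) (a : ℤ → K) {n : ℕ} (x : Fin (n + 1) → K) (b : Fin N → Fin 2) :
    ∑ b', transfer β (x (Fin.last n)) a b b' 0 1 *
        (if weight b' = n then G β (diagram b') (fun r => x r.castSucc) a else 0) =
      if weight b = n + 1 then G β (diagram b) x a else 0 := by
  classical
  split_ifs with hb
  -- `transfer_branch` needs a function vanishing on sets containing `(n, 0)`. Truncating `G`
  -- changes nothing when the first column of `μ` has no gaps, because `n + 1` boxes in a column
  -- cannot be filled with `n` letters.
  · let f : Finset (ℕ × ℕ) → K := fun μ =>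
      if (n, 0) ∈ μ then 0 else G β μ (fun r => x r.castSucc) a
    have hG : ∀ μ : Finset (ℕ × ℕ), (∀ i, (i + 1, 0) ∈ μ → (i, 0) ∈ μ) →
        f μ = G β μ (fun r => x r.castSucc) a := by
      intro μ hμ
      simp only [f]
      split_ifs with h
      · refine (G_eq_zero β (fun i hi => ?_) _ _).symm
        induction hi using Nat.decreasingInduction with
        | self => exact h
        | of_succ i _ ih => exact hμ i ih
      · rfl
    have hA := (transfer_branch β (x (Fin.last n)) a b).1 f fun μ hμ => if_pos (hμ n hb)
    rw [G_succ]
    refine Eq.trans (Finset.sum_congr rfl fun b' _ => ?_) (hA.trans ?_)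
    · split_ifs with hb'
      · rw [hG (diagram b') fun i hi => mem_diagram_of_succ_mem hi]
      · rw [(transfer_eq_zero β _ a b b').2 (by omega), zero_mul, zero_mul]
    · rw [branchSum]
      refine Finset.sum_congr rfl fun μ hμ => ?_
      rw [Finset.mem_powerset] at hμ
      have hw : (fun c : ℕ × ℕ => oplus β (x (Fin.last n)) (a ((weight b : ℤ) + c.2 - c.1))) =
          fun c => oplus β (x (Fin.last n)) (a ((n : ℤ) + 1 + c.2 - c.1)) := by
        rw [hb]
        push_cast
        rfl
      rw [hw]
      -- If the first column has a gap, `f` and `G` may differ, but the missing box has a box of the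
      -- diagram below it and the branching weight is zero.
      by_cases h : ∀ i, (i + 1, 0) ∈ μ → (i, 0) ∈ μ
      · rw [hG μ h]
      · push Not at h
        obtain ⟨i, h1, h2⟩ := h
        rw [branchWeight, Finset.prod_eq_zero (mem_diagram_of_succ_mem (hμ h1)), zero_mul, zero_mul]
        rw [if_pos (Or.inr (hμ h1)), if_neg h2]
  · refine Finset.sum_eq_zero fun b' _ => ?_
    split_ifs with hb'
    · rw [(transfer_eq_zero β _ a b b').2 (by omega), zero_mul]
    · rw [mul_zero]

/-- The relations between the two orders of a pair of row operators. -/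
lemma sum_transfer_mul_transfer (β x y : K) (a : ℤ → K) (b c : Fin N → Fin 2) :
    (∑ d, transfer β x a b d 0 0 * transfer β y a d c 0 0 =
      ∑ d, transfer β y a b d 0 0 * transfer β x a d c 0 0) ∧
    (∑ d, transfer β x a b d 0 1 * transfer β y a d c 0 1 =
      ∑ d, transfer β y a b d 0 1 * transfer β x a d c 0 1) ∧
    (∑ d, transfer β x a b d 0 0 * transfer β y a d c 0 1 =
      ∑ d, transfer β y a b d 0 0 * transfer β x a d c 0 1) ∧
    ((x - y) * (∑ d, transfer β x a b d 0 0 * transfer β y a d c 0 1) +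
        (1 + β * x) * ∑ d, transfer β x a b d 0 1 * transfer β y a d c 0 0 =
      (1 + β * y) * ∑ d, transfer β y a b d 0 1 * transfer β x a d c 0 0) := by
  induction N with
  | zero => simp [transfer]
  | succ N ih =>
    rw [← Fin.snoc_init_self b, ← Fin.snoc_init_self c]
    obtain ⟨h1, h2, h3, h4⟩ := ih (Fin.init b) (Fin.init c)
    generalize Fin.init b = b' at *
    generalize Fin.init c = c' at *
    have hb : b (Fin.last N) = 0 ∨ b (Fin.last N) = 1 := by omega
    have hc : c (Fin.last N) = 0 ∨ c (Fin.last N) = 1 := by omega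
    rcases hb with hb | hb <;> rcases hc with hc | hc <;>
    · rw [hb, hc]
      simp only [sum_snoc, transfer_snoc_zero_zero, transfer_snoc_zero_one, transfer_snoc_one_zero,
        transfer_snoc_one_one, mul_zero, zero_mul, Finset.sum_const_zero, add_zero, zero_add,
        mul_assoc, mul_left_comm (transfer _ _ _ _ _ _ _), ← Finset.mul_sum]
      generalize (∑ d, transfer β x a b' d 0 0 * transfer β y a d c' 0 0) = v00 at *
      generalize (∑ d, transfer β y a b' d 0 0 * transfer β x a d c' 0 0) = w00 at *
      generalize (∑ d, transfer β x a b' d 0 1 * transfer β y a d c' 0 1) = v11 at *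
      generalize (∑ d, transfer β y a b' d 0 1 * transfer β x a d c' 0 1) = w11 at *
      generalize (∑ d, transfer β x a b' d 0 0 * transfer β y a d c' 0 1) = v01 at *
      generalize (∑ d, transfer β y a b' d 0 0 * transfer β x a d c' 0 1) = w01 at *
      generalize (∑ d, transfer β x a b' d 0 1 * transfer β y a d c' 0 0) = v10 at *
      generalize (∑ d, transfer β y a b' d 0 1 * transfer β x a d c' 0 0) = w10 at *
      subst h1 h2 h3
      simp only [oplus]
      generalize a ((N : ℤ) + 1) = s
      refine ⟨?_, ?_, ?_, ?_⟩
      -- The goals are linear in the sums for `N` sites. The coefficient `1 + β * s` comes from `x ⊕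
      -- s - y ⊕ s = (x - y)(1 + β s)`. Only the second relation is used later; the others close the
      -- induction.
      all_goals first
        | trivial
        | ring1
        | linear_combination (1 + β * s) * h4
        | linear_combination (x + s + β * x * s) * h4

end Transfer

/-! ### From operators on the tensor product to products of scalar 2×2 matrices. -/

section MatrixElements

variable {K : Type*} [Field K] {N : ℕ}

lemma spinBasis_apply (b : Fin N → Fin 2) :
    spinBasis K N b = PiTensorProduct.tprod K fun j => (Pi.single (b j) 1 : V K) := by
  simp [spinBasis]

/-- The matrix elements of an operator acting on a single site. -/
lemma repr_site (j : Fin N) (X : Module.End K (V K)) (v : QSpace K N) (b : Fin N → Fin 2) :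
    (spinBasis K N).repr (site j X v) b =
      ∑ c, X (Pi.single c 1) (b j) * (spinBasis K N).repr v (Function.update b j c) := by
  let F : QSpace K N →ₗ[K] K := (spinBasis K N).coord b ∘ₗ site j X
  let H : QSpace K N →ₗ[K] K :=
    ∑ c, X (Pi.single c 1) (b j) • (spinBasis K N).coord (Function.update b j c)
  have : F = H := by
    refine (spinBasis K N).ext fun b' => ?_
    simp only [F, H, LinearMap.comp_apply, Module.Basis.coord_apply, LinearMap.sum_apply,
      LinearMap.smul_apply, smul_eq_mul]
    rw [spinBasis_apply, site, PiTensorProduct.map_tprod, ← spinBasis_apply, spinBasis,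
      Basis.piTensorProduct_repr_tprod_apply, ← spinBasis]
    simp only [Module.Basis.repr_self, Finsupp.single_apply, Pi.basisFun_repr]
    rw [← Finset.mul_prod_erase _ _ (Finset.mem_univ j)]
    rw [Finset.sum_eq_single (b' j)]
    · rw [Function.update_self]
      congr 1
      have h1 : (b' = Function.update b j (b' j)) ↔ ∀ i ∈ Finset.univ.erase j, b' i = b i := by
        rw [funext_iff]
        refine ⟨fun h i hi => ?_, fun h i => ?_⟩
        · rw [h i, Function.update_of_ne (Finset.ne_of_mem_erase hi)]
        · by_cases hi : i = j
          · subst hi; simp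
          · rw [Function.update_of_ne hi, h i (by simpa using hi)]
      rw [if_congr h1 rfl rfl]
      have h2 : ∏ i ∈ Finset.univ.erase j, (if b' i = b i then (1 : K) else 0) =
          if ∀ i ∈ Finset.univ.erase j, b' i = b i then 1 else 0 := by
        rw [Finset.prod_boole]
        congr
      rw [← h2]
      refine Finset.prod_congr rfl fun i hi => ?_
      rw [Function.update_of_ne (Finset.ne_of_mem_erase hi)]
      simp [Pi.single_apply, eq_comm]
    · intro c _ hc
      rw [if_neg, mul_zero]
      intro h
      exact hc (by rw [h, Function.update_self])
    · simp
  simpa [F, H] using congrArg (fun f => f v) this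

/-- The matrix elements, in the quantum space, of a block matrix of operators on a site. -/
def scalarBlock (X : Matrix (Fin 2) (Fin 2) (Module.End K (V K))) (c c' : Fin 2) :
    Matrix (Fin 2) (Fin 2) K :=
  X.map fun f => f (Pi.single c' 1) c

open Classical in
-- With no repeated site, each operator sees its own letter once and the letters off `l` are
-- unchanged. The string `b` stays general because the induction updates it at the leftmost site.
lemma repr_list_prod (X : Fin N → Matrix (Fin 2) (Fin 2) (Module.End K (V K)))
    (l : List (Fin N)) (hl : l.Nodup) (α γ : Fin 2) (b b' : Fin N → Fin 2) :
    (spinBasis K N).repr ((l.map fun j => (X j).map (site j)).prod α γ (spinBasis K N b')) b =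
      if ∀ i, i ∉ l → b i = b' i then
        (l.map fun j => scalarBlock (X j) (b j) (b' j)).prod α γ else 0 := by
  induction l generalizing α b with
  | nil =>
    have hb : (∀ i, i ∉ ([] : List (Fin N)) → b i = b' i) ↔ b' = b := by
      rw [eq_comm, funext_iff]
      simp
    simp only [List.map_nil, List.prod_nil, hb, Matrix.one_apply]
    by_cases h : α = γ <;> simp [h, Finsupp.single_apply]
  | cons j l ih =>
    rw [List.nodup_cons] at hl
    simp only [List.map_cons, List.prod_cons, Matrix.mul_apply, LinearMap.sum_apply,
      Module.End.mul_apply, Matrix.map_apply, map_sum, Finsupp.finsetSum_apply, repr_site]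
    have h0 : ∀ c, (l.map fun i => scalarBlock (X i) (Function.update b j c i) (b' i)) =
        l.map fun i => scalarBlock (X i) (b i) (b' i) := fun c =>
      List.map_congr_left fun i hi => by
        rw [Function.update_of_ne]
        rintro rfl
        exact hl.1 hi
    have h1 : ∀ c, (∀ i, i ∉ l → Function.update b j c i = b' i) ↔
        c = b' j ∧ ∀ i, i ∉ j :: l → b i = b' i := by
      intro c
      constructor
      · refine fun h => ⟨by simpa using h j hl.1, fun i hi => ?_⟩
        rw [List.mem_cons, not_or] at hi
        rw [← h i hi.2, Function.update_of_ne hi.1]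
      · rintro ⟨rfl, h⟩ i hi
        by_cases hij : i = j
        · subst hij; simp
        · rw [Function.update_of_ne hij, h i (by simp [hij, hi])]
    simp only [ih hl.2, h0, h1]
    split_ifs with h
    · have hp := eq_true h
      simp only [hp, and_true, mul_ite, mul_zero, Finset.sum_ite_eq', Finset.mem_univ, if_true]
      rfl
    · have hp := eq_false h
      simp only [hp, and_false, if_false, mul_zero, Finset.sum_const_zero]

lemma repr_ofFn_prod (X : Fin N → Matrix (Fin 2) (Fin 2) (Module.End K (V K)))
    (α γ : Fin 2) (b b' : Fin N → Fin 2) :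
    (spinBasis K N).repr
        ((List.ofFn fun j => (X j).map (site j)).prod α γ (spinBasis K N b')) b =
      (List.ofFn fun j => scalarBlock (X j) (b j) (b' j)).prod α γ := by
  have := repr_list_prod X (List.finRange N) (List.nodup_finRange N) α γ b b'
  simpa [List.ofFn_eq_map] using this

lemma repr_ofFn_reverse_prod (X : Fin N → Matrix (Fin 2) (Fin 2) (Module.End K (V K)))
    (α γ : Fin 2) (b b' : Fin N → Fin 2) :
    (spinBasis K N).repr
        ((List.ofFn fun j => (X j).map (site j)).reverse.prod α γ (spinBasis K N b')) b =
      (List.ofFn fun j => scalarBlock (X j) (b j) (b' j)).reverse.prod α γ := by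
  have := repr_list_prod X (List.finRange N).reverse
    (List.nodup_reverse.2 (List.nodup_finRange N)) α γ b b'
  simpa [List.ofFn_eq_map] using this

lemma list_reverse_prod_apply {ι R : Type*} [Fintype ι] [DecidableEq ι] [CommRing R]
    (l : List (Matrix ι ι R)) (α γ : ι) :
    l.reverse.prod α γ = (l.map Matrix.transpose).prod γ α := by
  rw [← Matrix.transpose_apply l.reverse.prod, Matrix.transpose_list_prod, List.map_reverse,
    List.reverse_reverse]

lemma ofFn_reverse {α : Type*} (f : Fin N → α) :
    (List.ofFn f).reverse = List.ofFn fun j => f j.rev := by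
  rw [List.ofFn_eq_map, ← List.map_reverse, List.finRange_reverse, List.map_map, List.ofFn_eq_map]
  rfl

end MatrixElements

/-! ### Iterating row operators, commutativity and the diagonal gauge. -/

section BetheVectors

variable {K : Type*} [Field K] {N : ℕ}

lemma repr_apply_eq_sum (f : Module.End K (QSpace K N)) (v : QSpace K N) (b : Fin N → Fin 2) :
    (spinBasis K N).repr (f v) b =
      ∑ b', (spinBasis K N).repr v b' * (spinBasis K N).repr (f (spinBasis K N b')) b := by
  conv_lhs => rw [← (spinBasis K N).sum_repr v]
  rw [map_sum, map_sum, Finsupp.finsetSum_apply]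
  simp only [map_smul, Finsupp.smul_apply, smul_eq_mul]

/-- Vectors created by successive operators which agree, up to a diagonal change of basis and a
relabelling `σ` of the spin basis, with the row operators. -/
lemma repr_reverse_prod_apply (β : K) (a : ℤ → K) {m : ℕ} (x : Fin m → K)
    (op : Fin m → Module.End K (QSpace K N)) (σ : (Fin N → Fin 2) ≃ (Fin N → Fin 2))
    (g : (Fin N → Fin 2) → K) (h : Fin m → K)
    (hop : ∀ i b b', (spinBasis K N).repr (op i (spinBasis K N b')) b * g b =
      h i * g b' * transfer β (x i) a (σ b) (σ b') 0 1)
    (b₀ : Fin N → Fin 2) (h₀ : σ b₀ = fun _ => 0) (b : Fin N → Fin 2) :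
    (spinBasis K N).repr ((List.ofFn op).reverse.prod (spinBasis K N b₀)) b * g b =
      (∏ i, h i) * g b₀ * if weight (σ b) = m then G β (diagram (σ b)) x a else 0 := by
  induction m generalizing b with
  | zero =>
    have hw : weight (σ b) = 0 ↔ b₀ = b := by
      rw [← σ.apply_eq_iff_eq, h₀, weight, Finset.card_eq_zero, ones, Finset.filter_eq_empty_iff,
        eq_comm, funext_iff]
      exact ⟨fun h j => by have := h (Finset.mem_univ j); omega,
        fun h j _ => by rw [h]; exact zero_ne_one⟩
    simp only [List.ofFn_zero, List.reverse_nil, List.prod_nil, Module.End.one_apply,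
      Module.Basis.repr_self, Finsupp.single_apply, Finset.univ_eq_empty, Finset.prod_empty, hw]
    split_ifs with hb
    · rw [diagram_eq_empty_of_weight_eq_zero (hw.2 hb), G_empty, hb]
      ring
    · ring
  | succ m ih =>
    rw [List.ofFn_succ', List.concat_eq_append, List.reverse_append, List.reverse_singleton,
      List.singleton_append, List.prod_cons, Module.End.mul_apply, repr_apply_eq_sum,
      Finset.sum_mul]
    have h1 : ∀ b', (spinBasis K N).repr ((List.ofFn fun i => op i.castSucc).reverse.prod
        (spinBasis K N b₀)) b' * (spinBasis K N).repr (op (Fin.last m) (spinBasis K N b')) b *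
          g b = (∏ i, h i) * g b₀ * (transfer β (x (Fin.last m)) a (σ b) (σ b') 0 1 *
            if weight (σ b') = m then G β (diagram (σ b')) (fun r => x r.castSucc) a else 0) := by
      intro b'
      rw [mul_assoc, hop, Fin.prod_univ_castSucc]
      have := ih (fun r => x r.castSucc) (fun i => op i.castSucc) (fun i => h i.castSucc)
        (fun i => hop i.castSucc) b'
      linear_combination
        h (Fin.last m) * transfer β (x (Fin.last m)) a (σ b) (σ b') 0 1 * this
    rw [Finset.sum_congr rfl fun b' _ => h1 b', ← Finset.mul_sum, ← sum_transfer_mul_G,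
      Equiv.sum_comp σ fun b' => transfer β (x (Fin.last m)) a (σ b) b' 0 1 *
        if weight b' = m then G β (diagram b') (fun r => x r.castSucc) a else 0]

lemma commute_of_repr_eq_transfer (β : K) (a : ℤ → K) (x y : K)
    (f f' : Module.End K (QSpace K N)) (σ : (Fin N → Fin 2) ≃ (Fin N → Fin 2))
    (hf : ∀ b b', (spinBasis K N).repr (f (spinBasis K N b')) b =
      transfer β x a (σ b) (σ b') 0 1)
    (hf' : ∀ b b', (spinBasis K N).repr (f' (spinBasis K N b')) b =
      transfer β y a (σ b) (σ b') 0 1) : Commute f f' := by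
  refine (spinBasis K N).ext fun b' => (spinBasis K N).ext_elem fun b => ?_
  rw [Module.End.mul_apply, Module.End.mul_apply, repr_apply_eq_sum, repr_apply_eq_sum f']
  simp only [hf, hf']
  have := (sum_transfer_mul_transfer β y x a (σ b) (σ b')).2.1
  rw [← Equiv.sum_comp σ, ← Equiv.sum_comp σ (fun d => transfer β x a (σ b) d 0 1 * _)] at this
  rw [Finset.sum_congr rfl fun d _ => mul_comm _ _]
  exact this.symm.trans (Finset.sum_congr rfl fun d _ => mul_comm _ _)

/-- Here the last operator acts first. Commutativity permits reversing the list, and the reversed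
order is the one that adds the variables of `x` successively. -/
lemma repr_prod_apply (β : K) (a : ℤ → K) {m : ℕ} (x : Fin m → K)
    (op : Fin m → Module.End K (QSpace K N)) (σ : (Fin N → Fin 2) ≃ (Fin N → Fin 2))
    (hop : ∀ i b b', (spinBasis K N).repr (op i (spinBasis K N b')) b =
      transfer β (x i) a (σ b) (σ b') 0 1)
    (b₀ : Fin N → Fin 2) (h₀ : σ b₀ = fun _ => 0) (b : Fin N → Fin 2) :
    (spinBasis K N).repr ((List.ofFn op).prod (spinBasis K N b₀)) b =
      if weight (σ b) = m then G β (diagram (σ b)) x a else 0 := by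
  have hc : (List.ofFn op).Pairwise Commute := by
    refine List.pairwise_of_forall_mem_list fun f hf f' hf' => ?_
    obtain ⟨i, rfl⟩ := (List.mem_ofFn' _ _).1 hf
    obtain ⟨j, rfl⟩ := (List.mem_ofFn' _ _).1 hf'
    exact commute_of_repr_eq_transfer β a _ _ _ _ σ (hop i) (hop j)
  rw [(List.reverse_perm (List.ofFn op)).symm.prod_eq' hc]
  have := repr_reverse_prod_apply β a x op σ (fun _ => 1) (fun _ => 1)
    (fun i b b' => by rw [hop]; ring) b₀ h₀ b
  simpa using this

/-- A diagonal change of basis moves the factor `1 + β(⋅)` to the other off-diagonal entry. -/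
lemma prod_apply_mul_prod_eq (p q : Fin N → Matrix (Fin 2) (Fin 2) K) (g g' : Fin N → K) (h : K)
    (h00 : ∀ j, p j 0 0 * g j = g' j * q j 0 0) (h01 : ∀ j, p j 0 1 * g j = h * g' j * q j 0 1)
    (h10 : ∀ j, h * p j 1 0 * g j = g' j * q j 1 0) (h11 : ∀ j, p j 1 1 * g j = g' j * q j 1 1) :
    (List.ofFn p).prod 0 0 * ∏ j, g j = (∏ j, g' j) * (List.ofFn q).prod 0 0 ∧
      (List.ofFn p).prod 0 1 * ∏ j, g j = h * (∏ j, g' j) * (List.ofFn q).prod 0 1 := by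
  -- Appending a factor on the right uses only the first row of the shorter product. Keeping `h` as
  -- a multiplier in `h10` avoids division: it will be `1 + β x`, which may vanish.
  induction N with
  | zero => simp
  | succ N ih =>
    obtain ⟨i0, i1⟩ := ih (fun j => p j.castSucc) (fun j => q j.castSucc) (fun j => g j.castSucc)
      (fun j => g' j.castSucc) (fun _ => h00 _) (fun _ => h01 _) (fun _ => h10 _) (fun _ => h11 _)
    have j00 := h00 (Fin.last N)
    have j01 := h01 (Fin.last N)
    have j10 := h10 (Fin.last N)
    have j11 := h11 (Fin.last N)
    simp only [List.ofFn_succ', List.concat_eq_append, List.prod_append, List.prod_singleton,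
      Fin.prod_univ_castSucc, Matrix.mul_apply, Fin.sum_univ_two]
    generalize (List.ofFn fun j => p j.castSucc).prod = P at *
    generalize (List.ofFn fun j => q j.castSucc).prod = Q at *
    generalize ∏ j : Fin N, g j.castSucc = A at *
    generalize ∏ j : Fin N, g' j.castSucc = A' at *
    generalize p (Fin.last N) = P' at *
    generalize q (Fin.last N) = Q' at *
    generalize g (Fin.last N) = c at *
    generalize g' (Fin.last N) = c' at *
    constructor
    · linear_combination P' 0 0 * c * i0 + A' * Q 0 0 * j00 + P' 1 0 * c * i1 + A' * Q 0 1 * j10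
    · linear_combination P' 0 1 * c * i0 + A' * Q 0 0 * j01 + P' 1 1 * c * i1 +
        h * A' * Q 0 1 * j11

lemma extend_natCast_add_one (t : Fin N → K) (j : Fin N) :
    extend t (((j : ℕ) : ℤ) + 1) = t j := by
  have h : 1 ≤ ((j : ℕ) : ℤ) + 1 ∧ ((j : ℕ) : ℤ) + 1 ≤ N := by omega
  rw [extend, dif_pos h]
  congr 1
  ext
  simp

lemma oplus_ominus_zero (β x : K) {s : K} (hs : 1 + β * s ≠ 0) :
    oplus β x (ominus β 0 s) = ominus β x s := by
  simp only [oplus, ominus]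
  have h1 := div_mul_cancel₀ (0 - s) hs
  rw [eq_div_iff hs]
  linear_combination (1 + β * x) * h1

lemma transfer_extend (β x : K) (t : Fin N → K) (b b' : Fin N → Fin 2) :
    transfer β x (extend t) b b' =
      (List.ofFn fun j => vertex β (oplus β x (t j)) (b j) (b' j)).prod := by
  simp only [transfer, extend_natCast_add_one]

lemma transfer_extend_neg (β x : K) (t : Fin N → K) (ht : ∀ j, 1 + β * t j ≠ 0)
    (b b' : Fin N → Fin 2) :
    transfer β x (extend (neg β t)) b b' =
      (List.ofFn fun j => vertex β (ominus β x (t j)) (b j) (b' j)).prod := by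
  simp only [transfer_extend, neg, oplus_ominus_zero β x (ht _)]

/-- Writing `Π(t_λ)` as a product over all sites exhibits it as a product of one-site gauge factors.
-/
lemma Pi1_sub (β : K) (t : Fin N → K) (b : Fin N → Fin 2) :
    Pi1 β (sub t b) = ∏ j, if b j = 1 then 1 + β * t j else 1 := by
  rw [← Finset.prod_filter, Pi1]
  change _ = ∏ j ∈ ones b, _
  refine (Finset.prod_bij (fun i _ => pos b i) (fun i _ => (ones b).orderEmbOfFin_mem rfl i)
    (fun i _ j _ h => ((ones b).orderEmbOfFin rfl).injective h) (fun j hj => ?_) fun i _ => rfl)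
  have : j ∈ Set.range ((ones b).orderEmbOfFin rfl) := by
    rw [Finset.range_orderEmbOfFin]
    exact hj
  obtain ⟨i, hi⟩ := this
  exact ⟨i, Finset.mem_univ _, hi⟩

/-- Reversal of binary strings. -/
def veeEquiv (N : ℕ) : (Fin N → Fin 2) ≃ (Fin N → Fin 2) where
  toFun := vee
  invFun := vee
  left_inv b := by funext j; simp [vee]
  right_inv b := by funext j; simp [vee]

/-- Exchange of the two letters of binary strings. -/
def starEquiv (N : ℕ) : (Fin N → Fin 2) ≃ (Fin N → Fin 2) where
  toFun := star
  invFun := star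
  left_inv b := by funext j; simp [star]
  right_inv b := by funext j; simp [star]

lemma weight_eq_sum (b : Fin N → Fin 2) : weight b = ∑ j, if b j = 1 then 1 else 0 := by
  rw [weight, ones, Finset.card_filter]

lemma weight_vee (b : Fin N → Fin 2) : weight (vee b) = weight b := by
  rw [weight_eq_sum, weight_eq_sum]
  exact Equiv.sum_comp Fin.revPerm fun j => if b j = 1 then 1 else 0

lemma weight_star (b : Fin N → Fin 2) : weight (star b) = N - weight b := by
  have h : ∀ c : Fin 2, 1 - c = 1 ↔ c = 0 := by decide
  rw [← card_zeros, weight, ones]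
  simp only [star, h]

lemma scalarBlock_Lvee (β x t : K) (c c' : Fin 2) :
    scalarBlock (Lvee β x t) c c' = vertex β (ominus β x t) c c' := by
  ext α γ
  fin_cases c <;> fin_cases c' <;> fin_cases α <;> fin_cases γ <;>
    simp [scalarBlock, Lvee, vertex, sigmaPlus, sigmaMinus, Matrix.mulVec, dotProduct]

lemma scalarBlock_Lstar (β x t : K) (c c' : Fin 2) :
    (scalarBlock (Lstar β x t) c c').transpose = vertex β (oplus β x t) (1 - c) (1 - c') := by
  ext α γ
  fin_cases c <;> fin_cases c' <;> fin_cases α <;> fin_cases γ <;>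
    simp [scalarBlock, Lstar, vertex, sigmaPlus, sigmaMinus, Matrix.mulVec, dotProduct]

/-- The four local gauge hypotheses in one formula; all rest on `(1 + β (x ⊖ t))(1 + β t) = 1 + β
x`. -/
lemma scalarBlock_L (β x t : K) (ht : 1 + β * t ≠ 0) (c c' : Fin 2) (α γ : Fin 2) :
    (if α = 1 ∧ γ = 0 then 1 + β * x else 1) * (scalarBlock (L β x t) c c' α γ *
        if c = 1 then 1 + β * t else 1) =
      (if α = 0 ∧ γ = 1 then 1 + β * x else 1) * (if c' = 1 then 1 + β * t else 1) *
        vertex β (ominus β x t) c c' α γ := by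
  have h1 := div_mul_cancel₀ (x - t) ht
  fin_cases c <;> fin_cases c' <;> fin_cases α <;> fin_cases γ <;>
    simp [scalarBlock, L, vertex, sigmaPlus, sigmaMinus, Matrix.mulVec, dotProduct] <;>
    simp only [ominus] <;> first
      | linear_combination β * h1
      | linear_combination -β * h1

/-- The same gauge after transposing the auxiliary space and exchanging letters, now from `1 + β (x
⊕ t) = (1 + β x)(1 + β t)`. -/
lemma scalarBlock_L' (β x t : K) (c c' : Fin 2) (α γ : Fin 2) :
    (if α = 1 ∧ γ = 0 then 1 + β * x else 1) * ((scalarBlock (L' β x t) c c').transpose α γ *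
        if c = 1 then 1 + β * t else 1) =
      (if α = 0 ∧ γ = 1 then 1 + β * x else 1) * (if c' = 1 then 1 + β * t else 1) *
        vertex β (oplus β x t) (1 - c) (1 - c') α γ := by
  fin_cases c <;> fin_cases c' <;> fin_cases α <;> fin_cases γ <;>
    simp [scalarBlock, L', vertex, sigmaPlus, sigmaMinus, Matrix.mulVec, dotProduct] <;>
    simp only [oplus] <;> ring

end BetheVectors

/-! ### The four operators in the spin basis, and the resulting expansions. -/

section BetheVectors

variable {K : Type*} [Field K] {N : ℕ}

/-- The product runs from site `N` down to `1`, so it is a row operator for the reversed string and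
reversed parameters. -/
lemma repr_B (β x : K) (t : Fin N → K) (ht : ∀ j, 1 + β * t j ≠ 0) (b b' : Fin N → Fin 2) :
    (spinBasis K N).repr (B β x t (spinBasis K N b')) b * Pi1 β (sub t b) =
      (1 + β * x) * Pi1 β (sub t b') *
        transfer β x (extend (neg β (reverse t))) (vee b) (vee b') 0 1 := by
  have key := (prod_apply_mul_prod_eq
    (fun j : Fin N => scalarBlock (L β x (t j.rev)) (b j.rev) (b' j.rev))
    (fun j => vertex β (ominus β x (t j.rev)) (b j.rev) (b' j.rev))
    (fun j => if b j.rev = 1 then 1 + β * t j.rev else 1)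
    (fun j => if b' j.rev = 1 then 1 + β * t j.rev else 1) (1 + β * x)
    (fun j => by simpa using scalarBlock_L β x (t j.rev) (ht _) (b j.rev) (b' j.rev) 0 0)
    (fun j => by simpa using scalarBlock_L β x (t j.rev) (ht _) (b j.rev) (b' j.rev) 0 1)
    (fun j => by
      simpa [mul_assoc] using scalarBlock_L β x (t j.rev) (ht _) (b j.rev) (b' j.rev) 1 0)
    (fun j => by simpa using scalarBlock_L β x (t j.rev) (ht _) (b j.rev) (b' j.rev) 1 1)).2
  have hp : ∀ c : Fin N → Fin 2, Pi1 β (sub t c) =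
      ∏ j : Fin N, if c j.rev = 1 then 1 + β * t j.rev else 1 := fun c => by
    rw [Pi1_sub]
    exact (Equiv.prod_comp Fin.revPerm fun j => if c j = 1 then 1 + β * t j else 1).symm
  rw [B, M, repr_ofFn_reverse_prod, ofFn_reverse, hp, hp,
    transfer_extend_neg β x (reverse t) fun _ => ht _]
  exact key

/-- Auxiliary transposition turns the lower left entry into the upper right one and also restores
the increasing order of sites, so only the letters are exchanged. -/
lemma repr_C' (β x : K) (t : Fin N → K) (b b' : Fin N → Fin 2) :
    (spinBasis K N).repr (C' β x t (spinBasis K N b')) b * Pi1 β (sub t b) =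
      (1 + β * x) * Pi1 β (sub t b') * transfer β x (extend t) (star b) (star b') 0 1 := by
  have key := (prod_apply_mul_prod_eq
    (fun j : Fin N => (scalarBlock (L' β x (t j)) (b j) (b' j)).transpose)
    (fun j => vertex β (oplus β x (t j)) (1 - b j) (1 - b' j))
    (fun j => if b j = 1 then 1 + β * t j else 1)
    (fun j => if b' j = 1 then 1 + β * t j else 1) (1 + β * x)
    (fun j => by simpa using scalarBlock_L' β x (t j) (b j) (b' j) 0 0)
    (fun j => by simpa using scalarBlock_L' β x (t j) (b j) (b' j) 0 1)
    (fun j => by simpa [mul_assoc] using scalarBlock_L' β x (t j) (b j) (b' j) 1 0)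
    (fun j => by simpa using scalarBlock_L' β x (t j) (b j) (b' j) 1 1)).2
  rw [C', M', repr_ofFn_reverse_prod, list_reverse_prod_apply, List.map_ofFn, Pi1_sub, Pi1_sub,
    transfer_extend]
  exact key

lemma repr_Cvee (β x : K) (t : Fin N → K) (ht : ∀ j, 1 + β * t j ≠ 0) (b b' : Fin N → Fin 2) :
    (spinBasis K N).repr (Cvee β x t (spinBasis K N b')) b =
      transfer β x (extend (neg β t)) b b' 0 1 := by
  rw [Cvee, Matrix.transpose_apply, Mvee, repr_ofFn_prod, transfer_extend_neg β x t ht]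
  simp only [scalarBlock_Lvee]

/-- The sites are in increasing order, but the local matrices match `vertex` only after
transposition, which reverses them; hence both reversal and exchange, with no gauge. -/
lemma repr_Bstar (β x : K) (t : Fin N → K) (b b' : Fin N → Fin 2) :
    (spinBasis K N).repr (Bstar β x t (spinBasis K N b')) b =
      transfer β x (extend (reverse t)) (vee (star b)) (vee (star b')) 0 1 := by
  rw [Bstar, Matrix.transpose_apply, Mstar, repr_ofFn_prod, transfer_extend,
    ← List.reverse_reverse (List.ofFn _), list_reverse_prod_apply, ofFn_reverse, List.map_ofFn]
  simp only [Function.comp_def, scalarBlock_Lstar]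
  rfl

lemma toDual_eq_sum (v : QSpace K N) (P : (Fin N → Fin 2) → Prop) [DecidablePred P]
    (F : (Fin N → Fin 2) → K) (h : ∀ b, (spinBasis K N).repr v b = if P b then F b else 0) :
    (spinBasis K N).toDual v = ∑ b with P b, F b • dualSpin b := by
  refine (spinBasis K N).ext fun b => ?_
  rw [Module.Basis.toDual_apply_left, h, LinearMap.sum_apply, Finset.sum_filter]
  rw [Finset.sum_eq_single b]
  · by_cases hb : P b <;> simp [dualSpin, hb]
  · intro c _ hc
    by_cases hb : P c <;> simp [dualSpin, hb, hc.symm]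
  · simp

lemma eq_smul_sum (v : QSpace K N) (P : (Fin N → Fin 2) → Prop) [DecidablePred P] (s : K)
    (F : (Fin N → Fin 2) → K) (h : ∀ b, (spinBasis K N).repr v b = s * if P b then F b else 0) :
    v = s • ∑ b with P b, F b • spinBasis K N b := by
  refine (spinBasis K N).ext_elem fun b => ?_
  rw [h, map_smul, map_sum, Finset.sum_filter, Finsupp.smul_apply, Finsupp.finsetSum_apply,
    Finset.sum_eq_single b]
  · by_cases hb : P b <;> simp [hb]
  · intro c _ hc
    by_cases hb : P c <;> simp [hb, hc]
  · simp

lemma Pi1_sub_ne_zero (β : K) (t : Fin N → K) (ht : ∀ j, 1 + β * t j ≠ 0) (b : Fin N → Fin 2) :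
    Pi1 β (sub t b) ≠ 0 :=
  Finset.prod_ne_zero_iff.2 fun _ _ => ht _

lemma Pi1_sub_zero (β : K) (t : Fin N → K) : Pi1 β (sub t fun _ => 0) = 1 := by
  simp [Pi1_sub]

/-- The gauge factor of the all-ones vector, divided by that of `b`, leaves the factors at the
zeros; this is how `Π(t_{λ^*})` enters `bethe'_eq`. -/
lemma Pi1_sub_mul_Pi1_sub_star (β : K) (t : Fin N → K) (b : Fin N → Fin 2) :
    Pi1 β (sub t (star b)) * Pi1 β (sub t b) = Pi1 β (sub t fun _ => 1) := by
  simp only [Pi1_sub, ← Finset.prod_mul_distrib, star]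
  refine Finset.prod_congr rfl fun j _ => ?_
  have : b j = 0 ∨ b j = 1 := by omega
  rcases this with h | h <;> simp [h]

lemma weight_star_eq_iff {n k : ℕ} (hN : n + k = N) (b : Fin N → Fin 2) :
    weight (star b) = k ↔ weight b = n := by
  rw [weight_star]
  have := weight_le b
  omega

lemma bethe_eq (β : K) (t : Fin N → K) (ht : ∀ j, 1 + β * t j ≠ 0) {n : ℕ} (y : Fin n → K) :
    bethe β t y = Pi1 β y • ∑ b : Fin N → Fin 2 with weight b = n,
      (G β (diagram (vee b)) y (extend (neg β (reverse t))) / Pi1 β (sub t b)) •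
        spinBasis K N b := by
  refine eq_smul_sum _ _ _ _ fun b => ?_
  have h := repr_reverse_prod_apply β _ y (fun i => B β (y i) t) (veeEquiv N)
    (fun b => Pi1 β (sub t b)) (fun i => 1 + β * y i) (fun i => repr_B β (y i) t ht)
    (fun _ => 0) rfl b
  have hb := Pi1_sub_ne_zero β t ht b
  simp only [Pi1_sub_zero, mul_one, veeEquiv, Equiv.coe_fn_mk, weight_vee] at h
  rw [bethe, uniform, eq_div_of_mul_eq hb h, mul_div_assoc, ite_div, zero_div]
  rfl

lemma bethe'_eq {n k : ℕ} (hN : n + k = N) (β : K) (t : Fin N → K)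
    (ht : ∀ j, 1 + β * t j ≠ 0) (z : Fin k → K) :
    bethe' β t z = Pi1 β z • ∑ b : Fin N → Fin 2 with weight b = n,
      (G β (diagram (star b)) z (extend t) * Pi1 β (sub t (star b))) • spinBasis K N b := by
  have hstar := weight_star_eq_iff hN
  refine eq_smul_sum _ _ _ _ fun b => ?_
  have h := repr_reverse_prod_apply β _ z (fun i => C' β (z i) t) (starEquiv N)
    (fun b => Pi1 β (sub t b)) (fun i => 1 + β * z i) (fun i => repr_C' β (z i) t)
    (fun _ => 1) (funext fun _ => sub_self 1) b
  have hb := Pi1_sub_ne_zero β t ht b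
  simp only [← Pi1_sub_mul_Pi1_sub_star β t b, starEquiv, Equiv.coe_fn_mk, hstar] at h
  rw [bethe', uniform]
  refine mul_right_cancel₀ hb (h.trans ?_)
  rw [show ∏ i, (1 + β * z i) = Pi1 β z from rfl]
  split_ifs <;> ring

lemma dualBethe_eq (β : K) (t : Fin N → K) (ht : ∀ j, 1 + β * t j ≠ 0) {n : ℕ} (y : Fin n → K) :
    dualBethe β t y = ∑ b : Fin N → Fin 2 with weight b = n,
      G β (diagram b) y (extend (neg β t)) • dualSpin b := by
  refine toDual_eq_sum _ _ _ fun b => ?_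
  rw [uniform, repr_prod_apply β _ y (fun i => Cvee β (y i) t) (Equiv.refl _)
    (fun i => repr_Cvee β (y i) t ht) (fun _ => 0) rfl b]
  rfl

lemma dualBethe'_eq {n k : ℕ} (hN : n + k = N) (β : K) (t : Fin N → K) (z : Fin k → K) :
    dualBethe' β t z = ∑ b : Fin N → Fin 2 with weight b = n,
      G β (conjugate (diagram b)) z (extend (reverse t)) • dualSpin b := by
  have hstar := weight_star_eq_iff hN
  refine toDual_eq_sum _ _ _ fun b => ?_
  rw [uniform, repr_prod_apply β _ z (fun i => Bstar β (z i) t)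
    ((starEquiv N).trans (veeEquiv N)) (fun i => repr_Bstar β (z i) t) (fun _ => 1)
    (funext fun _ => sub_self 1) b]
  change (if weight (vee (star b)) = k then G β (diagram (vee (star b))) z _ else 0) = _
  rw [conjugate_diagram, weight_vee]
  simp only [hstar]

end BetheVectors

end

end BetheGrothendieck

theorem mainTheorem11 {K : Type*} [Field K] (n k N : ℕ) (hN : n + k = N) (β : K)
    (t : Fin N → K) (ht : ∀ j, 1 + β * t j ≠ 0) (y : Fin n → K) (z : Fin k → K) :
    (BetheGrothendieck.bethe β t y =
      BetheGrothendieck.Pi1 β y •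
        ∑ b : Fin N → Fin 2 with BetheGrothendieck.weight b = n,
          (BetheGrothendieck.G β (BetheGrothendieck.diagram (BetheGrothendieck.vee b)) y
              (BetheGrothendieck.extend
                (BetheGrothendieck.neg β (BetheGrothendieck.reverse t))) /
            BetheGrothendieck.Pi1 β (BetheGrothendieck.sub t b)) •
            BetheGrothendieck.spinBasis K N b) ∧
    (BetheGrothendieck.bethe' β t z =
      BetheGrothendieck.Pi1 β z •
        ∑ b : Fin N → Fin 2 with BetheGrothendieck.weight b = n,
          (BetheGrothendieck.G β (BetheGrothendieck.diagram (BetheGrothendieck.star b)) z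
              (BetheGrothendieck.extend t) *
            BetheGrothendieck.Pi1 β (BetheGrothendieck.sub t (BetheGrothendieck.star b))) •
            BetheGrothendieck.spinBasis K N b) ∧
    (BetheGrothendieck.dualBethe β t y =
      ∑ b : Fin N → Fin 2 with BetheGrothendieck.weight b = n,
        BetheGrothendieck.G β (BetheGrothendieck.diagram b) y
            (BetheGrothendieck.extend (BetheGrothendieck.neg β t)) •
          BetheGrothendieck.dualSpin b) ∧
    (BetheGrothendieck.dualBethe' β t z =
      ∑ b : Fin N → Fin 2 with BetheGrothendieck.weight b = n,
        BetheGrothendieck.G β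
            (BetheGrothendieck.conjugate (BetheGrothendieck.diagram b)) z
            (BetheGrothendieck.extend (BetheGrothendieck.reverse t)) •
          BetheGrothendieck.dualSpin b) := by
  exact ⟨BetheGrothendieck.bethe_eq β t ht y, BetheGrothendieck.bethe'_eq hN β t ht z,
    BetheGrothendieck.dualBethe_eq β t ht y, BetheGrothendieck.dualBethe'_eq hN β t z⟩
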